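/- Let $n \ge 1$. **Objects.** * An ascent sequence of length $n$ is a sequence $(a_1,\dots,a_n)$ of non-negative integers with $a_1=0$ and $a_i \le \mathrm{asc}(a_1,\dots,a_{i-1})+1$ for $1<i\le n$, where $\mathrm{asc}$ counts ascents. A word contains a pattern if some subsequence has the same relative order (including equalities) as the pattern. $\mathsf{CAsc}_n$ is the set of $101$-avoiding ascent sequences of length $n$. * $\mathsf{CPosets}_n$ is the set of unlabelled posets on $n$ elements with no induced subposet isomorphic to $2+2$ (two disjoint 2-element chains) or to $N$ (the poset $e<h>f<g$ with no other relations), i.e. the series-parallel interval orders. In a $(2+2)$-free poset $P$ the distinct strict downsets $D(x)=\{y: y\prec x\}$ form a chain $\emptyset=D_0\subsetneq D_1\subsetneq\dots\subsetneq D_{\ell(P)}$; $L_i=\{x : D(x)=D_i\}$ is level $i$, $D_{\ell(P)+1}:=P$, and $\ell^\star(P)$ is the least index of a level containing a maximal element. * $\mathsf{CMatrices}_n$ is the set of upper-triangular square matrices over $\mathbb{N}$ with no zero row, no zero column and sum of entries $n$ (Fishburn matrices) that are SE-free: there are no non-zero entries $m_{ij}$, $m_{i'j'}$ with $i<i'$,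 $j<j'$, $i'\le j$. * $\mathcal S_n(231)$ is the set of $231$-avoiding permutations of length $n$. **Maps.** * $f_{AP}$: start with the one-element poset for $(a_1)$. Given $P=f_{AP}(a_1,\dots,a_k)$ and $a=a_{k+1}$: if $a\le \ell^\star(P)$, add a new maximal element with strict downset $D_a$; if $a=\ell(P)+1$, add a new element above all others; if $\ell^\star(P)<a\le\ell(P)$, add a new maximal element with strict downset $D_a$ and put every maximal element of $P$ at a level less than $a$ below every element of $P$ at a level at least $a$. * $f_{PM}(P)$ is the $(\ell(P)+1)\times(\ell(P)+1)$ matrix with $(i,j)$ entry $|L_{i-1}\cap(D_j\setminus D_{j-1})|$. * $f_{AS}$: start with the permutation $1$ for $(a_1)$. For $k=2,\dots,n$, insert $k$ into $\pi=f_{AS}(a_1,\dots,a_{k-1})$ at the active site labelled $a_k$. Here the site before position $1$ and the site after the last position are active, the site between positions $i$ and $i+1$ is active if $\pi_i=1$ or $\pi_i-1$ is to the left of $\pi_i$, and active sites are labelled $0,1,2,\dots$ from left to right. * $f_{AM}$: start with the $1\times1$ matrix $(1)$ for $(a_1)$. Given $M=f_{AM}(a_1,\dots,a_k)$ of dimension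 $d$ and $a=a_{k+1}$, let $\mathrm{mindex}(M)$ be the least index of a row with non-zero rightmost entry. If $a<\mathrm{mindex}(M)$, increase the entry $(a+1,d)$ by one; if $a=d$, append a zero row and a zero column and put $1$ in the new diagonal entry; if $\mathrm{mindex}(M)\le a<d$, insert a new row and a new column between rows, respectively columns, $a$ and $a+1$, where the new row is zero except for a rightmost entry $1$, the entries of the rightmost column above the new row are moved to the left into the new column (and replaced by zeros), and all other entries of the new column are zero. **Statement.** These maps among ascent sequences, $(2+2)$-free posets, Fishburn matrices and permutations restrict to bijections among $\mathsf{CAsc}_n$, $\mathsf{CPosets}_n$, $\mathsf{CMatrices}_n$ and $\mathcal S_n(231)$. Specifically: * (a) $f_{AP}$ maps $\mathsf{CAsc}_n$ bijectively onto $\mathsf{CPosets}_n$; * (b) $f_{PM}$ maps $\mathsf{CPosets}_n$ bijectively onto $\mathsf{CMatrices}_n$; * (c) $f_{AS}$ maps $\mathsf{CAsc}_n$ bijectively onto $\mathcal S_n(231)$; * (d) $f_{AM}$ maps $\mathsf{CAsc}_n$ bijectively onto $\mathsf{CMatrices}_n$. -/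

import Mathlib

namespace Fishburn

/-! ### Patterns and ascent sequences -/

/-- The word `a` contains the word `p` as a pattern: some subsequence of `a` has its entries in the
same relative order as the entries of `p` (equal entries of `p` correspond to equal entries). -/
def ContainsPattern {α β : Type*} [LinearOrder α] [LinearOrder β] {m k : ℕ}
    (a : Fin m → α) (p : Fin k → β) : Prop :=
  ∃ e : Fin k ↪o Fin m, ∀ i j : Fin k, a (e i) < a (e j) ↔ p i < p j

/-- The number of ascents of a finite sequence. -/
noncomputable def asc {n : ℕ} (a : Fin n → ℕ) : ℕ :=
  Set.ncard {i : Fin n | ∃ j : Fin n, (j : ℕ) = (i : ℕ) + 1 ∧ a i < a j}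

/-- Ascent sequences of length `n` (the entry written `a_{k+1}` on paper is `a k` here):
the first entry is `0`, and every later entry is at most one more than the number of ascents of the
prefix that precedes it. -/
def Asc (n : ℕ) : Set (Fin n → ℕ) :=
  {a | ∀ i : Fin n, ((i : ℕ) = 0 → a i = 0) ∧
    (0 < (i : ℕ) → a i ≤ asc (fun j : Fin i => a (Fin.castLE i.isLt.le j)) + 1)}

/-- The ascent sequences of length `n` that avoid the pattern `101`. -/
def CAsc (n : ℕ) : Set (Fin n → ℕ) :=
  {a | a ∈ Asc n ∧ ¬ ContainsPattern a ![1, 0, 1]}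

/-! ### Unlabelled posets

A labelled poset on `n` elements is given by its strict order relation on `Fin n`; an unlabelled one
is an isomorphism class of such relations. -/

/-- Isomorphism of binary relations on `Fin n`. -/
def relSetoid (n : ℕ) : Setoid (Fin n → Fin n → Prop) where
  r r s := Nonempty (r ≃r s)
  iseqv := ⟨fun r => ⟨RelIso.refl r⟩, fun ⟨e⟩ => ⟨e.symm⟩, fun ⟨e⟩ ⟨f⟩ => ⟨e.trans f⟩⟩

/-- Isomorphism classes of binary relations on `n` elements. -/
def Unlabelled (n : ℕ) : Type := Quotient (relSetoid n)

/-- The isomorphism class of a relation. -/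
def Unlabelled.mk {n : ℕ} (r : Fin n → Fin n → Prop) : Unlabelled n := Quotient.mk (relSetoid n) r

/-- The strict order of `2+2`, the disjoint union of two 2-element chains. -/
def twoPlusTwo : Fin 2 ⊕ Fin 2 → Fin 2 ⊕ Fin 2 → Prop := Sum.LiftRel (· < ·) (· < ·)

/-- The strict order of the poset `N` on four elements: `0 < 2 > 1 < 3`. -/
def nPoset (i j : Fin 4) : Prop := (i = 0 ∧ j = 2) ∨ (i = 1 ∧ j = 2) ∨ (i = 1 ∧ j = 3)

/-- `r` has no induced suborder isomorphic to `s`. -/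
def Free {α β : Type*} (s : β → β → Prop) (r : α → α → Prop) : Prop := IsEmpty (s ↪r r)

/-- The unlabelled (2+2)-free posets on `n` elements. -/
def Posets (n : ℕ) : Set (Unlabelled n) :=
  {P | ∃ r : Fin n → Fin n → Prop, P = Unlabelled.mk r ∧ IsStrictOrder (Fin n) r ∧
    Free twoPlusTwo r}

/-- The unlabelled posets on `n` elements that are both (2+2)-free and N-free, that is, the
series-parallel interval orders. -/
def CPosets (n : ℕ) : Set (Unlabelled n) :=
  {P | ∃ r : Fin n → Fin n → Prop, P = Unlabelled.mk r ∧ IsStrictOrder (Fin n) r ∧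
    Free twoPlusTwo r ∧ Free nPoset r}

/-! ### Levels -/

section Levels

variable {n : ℕ} (r : Fin n → Fin n → Prop)

/-- The strict downset `D(x)`. -/
def down (x : Fin n) : Set (Fin n) := {y | r y x}

/-- `ℓ(P)`: the number of distinct nonempty strict downsets. -/
noncomputable def ell : ℕ := Set.ncard (Set.range (down r) \ {∅})

/-- The level of `x`: the number of strict downsets properly contained in `D(x)`. If the strict
downsets are `D_0 ⊂ D_1 ⊂ ...`, this is the index `i` with `D(x) = D_i`. -/
noncomputable def level (x : Fin n) : ℕ := Set.ncard {D | D ∈ Set.range (down r) ∧ D ⊂ down r x}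

/-- The set `D_i`, the common strict downset of the elements at level `i`. -/
def downAt (i : ℕ) : Set (Fin n) := {y | ∃ x, level r x = i ∧ r y x}

/-- `x` is a maximal element. -/
def IsMaxElt (x : Fin n) : Prop := ∀ y, ¬ r x y

/-- `ℓ*(P)`: the least index of a level that contains a maximal element. -/
noncomputable def ellStar : ℕ := sInf {i | ∃ x, IsMaxElt r x ∧ level r x = i}

end Levels

/-! ### From ascent sequences to posets -/

/-- Add to `r` a new maximal element (the last one) whose strict downset is `D`. -/
def addMax {n : ℕ} (r : Fin n → Fin n → Prop) (D : Set (Fin n)) (x y : Fin (n + 1)) : Prop :=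
  Fin.lastCases (motive := fun _ => Prop) False
    (fun i => Fin.lastCases (motive := fun _ => Prop) (i ∈ D) (fun j => r i j) y) x

/-- One step of the construction, with next entry `a`. The three branches are
* `a ≤ ℓ*`: add an element covering what the elements at level `a` cover;
* `a = ℓ + 1`: add an element covering all maximal elements, hence lying above everything;
* `ℓ* < a ≤ ℓ`: add an element covering what the elements at level `a` cover, and put every old
  maximal element at a level `< a` below every old element at a level `≥ a`. -/
noncomputable def apStep {n : ℕ} (r : Fin n → Fin n → Prop) (a : ℕ) :
    Fin (n + 1) → Fin (n + 1) → Prop :=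
  if a ≤ ellStar r then addMax r (downAt r a)
  else if a = ell r + 1 then addMax r Set.univ
  else addMax (fun i j => r i j ∨ (IsMaxElt r i ∧ level r i < a ∧ a ≤ level r j)) (downAt r a)

/-- The labelled poset built from a sequence, one entry at a time. The first step, from the
empty poset with entry `0`, gives the one-element poset. -/
noncomputable def labelledAP : (n : ℕ) → (Fin n → ℕ) → Fin n → Fin n → Prop
  | 0, _ => fun _ _ => False
  | n + 1, a => apStep (labelledAP n (Fin.init a)) (a (Fin.last n))

/-- The map from ascent sequences to unlabelled (2+2)-free posets. -/
noncomputable def fAP {n : ℕ} (a : Fin n → ℕ) : Unlabelled n := Unlabelled.mk (labelledAP n a)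

/-! ### Matrices -/

/-- Square matrices of natural numbers of arbitrary dimension. -/
abbrev SqMat : Type := Σ d : ℕ, Matrix (Fin d) (Fin d) ℕ

/-- Fishburn matrices of size `n`: upper-triangular, without zero rows or zero columns, with sum of
entries `n`. -/
def Matrices (n : ℕ) : Set SqMat :=
  {M | (∀ i j, j < i → M.2 i j = 0) ∧ (∀ i, ∃ j, M.2 i j ≠ 0) ∧ (∀ j, ∃ i, M.2 i j ≠ 0) ∧
    ∑ i, ∑ j, M.2 i j = n}

/-- `M` has no two nonzero entries `m_{ij}`, `m_{i'j'}` with `i < i'`, `j < j'` and `i' ≤ j`. -/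
def SEFree (M : SqMat) : Prop :=
  ¬ ∃ i j i' j' : Fin M.1, M.2 i j ≠ 0 ∧ M.2 i' j' ≠ 0 ∧ i < i' ∧ j < j' ∧ i' ≤ j

/-- The SE-free Fishburn matrices of size `n`. -/
def CMatrices (n : ℕ) : Set SqMat := {M | M ∈ Matrices n ∧ SEFree M}

/-! ### From posets to matrices -/

/-- The set `D_j` for `0 ≤ j ≤ ℓ + 1`, where `D_{ℓ+1}` is the whole poset by convention. -/
noncomputable def downAtExt {n : ℕ} (r : Fin n → Fin n → Prop) (j : ℕ) : Set (Fin n) :=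
  if j = ell r + 1 then Set.univ else downAt r j

/-- The `(ℓ+1) × (ℓ+1)` matrix whose entry in row `i` and column `j` (counted from `0`) is
`|L_i ∩ (D_{j+1} \ D_j)|`. -/
noncomputable def labelledPM {n : ℕ} (r : Fin n → Fin n → Prop) : SqMat :=
  ⟨ell r + 1, fun i j =>
    Set.ncard ({x | level r x = (i : ℕ)} ∩ (downAtExt r ((j : ℕ) + 1) \ downAtExt r (j : ℕ)))⟩

theorem down_image {n : ℕ} {r s : Fin n → Fin n → Prop} (e : r ≃r s) (x : Fin n) :
    down s (e x) = e '' down r x := by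
  ext y
  simp only [down, Set.mem_image, Set.mem_ofPred_eq]
  constructor
  · intro h
    exact ⟨e.symm y, by rw [← e.map_rel_iff]; simpa using h, by simp⟩
  · rintro ⟨z, hz, rfl⟩
    exact e.map_rel_iff.2 hz

theorem range_down {n : ℕ} {r s : Fin n → Fin n → Prop} (e : r ≃r s) :
    Set.range (down s) = (fun D => e '' D) '' Set.range (down r) := by
  rw [← Set.range_comp, ← e.surjective.range_comp (down s)]
  exact congrArg Set.range (funext fun x => down_image e x)

theorem ell_eq {n : ℕ} {r s : Fin n → Fin n → Prop} (e : r ≃r s) : ell s = ell r := by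
  have hinj : Function.Injective (fun D : Set (Fin n) => e '' D) := e.injective.image_injective
  unfold ell
  rw [range_down e, ← Set.ncard_image_of_injective (Set.range (down r) \ {∅}) hinj,
    Set.image_sdiff hinj]
  simp

theorem level_eq {n : ℕ} {r s : Fin n → Fin n → Prop} (e : r ≃r s) (x : Fin n) :
    level s (e x) = level r x := by
  have hinj : Function.Injective (fun D : Set (Fin n) => e '' D) := e.injective.image_injective
  have hss : ∀ {A B : Set (Fin n)}, e '' A ⊂ e '' B ↔ A ⊂ B := by
    intro A B
    simp only [ssubset_iff_subset_not_subset, Set.image_subset_image_iff e.injective]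
  unfold level
  rw [← Set.ncard_image_of_injective {D | D ∈ Set.range (down r) ∧ D ⊂ down r x} hinj]
  congr 1
  ext D
  simp only [range_down e, down_image e, Set.mem_image, Set.mem_ofPred_eq]
  constructor
  · rintro ⟨⟨D', hD', rfl⟩, h⟩
    exact ⟨D', ⟨hD', hss.1 h⟩, rfl⟩
  · rintro ⟨D', ⟨hD', h⟩, rfl⟩
    exact ⟨⟨D', hD', rfl⟩, hss.2 h⟩

theorem mem_downAtExt {n : ℕ} {r s : Fin n → Fin n → Prop} (e : r ≃r s) (j : ℕ) (x : Fin n) :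
    e x ∈ downAtExt s j ↔ x ∈ downAtExt r j := by
  unfold downAtExt
  rw [ell_eq e]
  split_ifs
  · simp
  · constructor
    · rintro ⟨z, hz, hr⟩
      refine ⟨e.symm z, ?_, ?_⟩
      · rw [← level_eq e]; simpa using hz
      · rw [← e.map_rel_iff]; simpa using hr
    · rintro ⟨z, hz, hr⟩
      exact ⟨e z, by rw [level_eq e, hz], e.map_rel_iff.2 hr⟩

theorem labelledPM_eq {n : ℕ} {r s : Fin n → Fin n → Prop} (e : r ≃r s) :
    labelledPM r = labelledPM s := by
  have key : ∀ i j : ℕ,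
      Set.ncard ({x | level r x = i} ∩ (downAtExt r (j + 1) \ downAtExt r j)) =
      Set.ncard ({x | level s x = i} ∩ (downAtExt s (j + 1) \ downAtExt s j)) := by
    intro i j
    rw [← Set.ncard_image_of_injective _ e.injective]
    congr 1
    ext y
    obtain ⟨x, rfl⟩ := e.surjective y
    simp only [Set.mem_image, e.injective.eq_iff, exists_eq_right, Set.mem_inter_iff,
      Set.mem_ofPred_eq, Set.mem_sdiff, level_eq e, mem_downAtExt e]
  unfold labelledPM
  simp only [key]
  exact congrArg (fun d => (⟨d + 1, fun i j => Set.ncard ({x | level s x = (i : ℕ)} ∩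
    (downAtExt s ((j : ℕ) + 1) \ downAtExt s (j : ℕ)))⟩ : SqMat)) (ell_eq e).symm

/-- The map from unlabelled (2+2)-free posets to matrices. -/
noncomputable def fPM {n : ℕ} : Unlabelled n → SqMat :=
  Quotient.lift labelledPM fun _ _ ⟨e⟩ => labelledPM_eq e

/-! ### From ascent sequences to matrices -/

/-- The least index, counted from `1`, of a row whose rightmost entry is nonzero. -/
noncomputable def mindex {d : ℕ} (M : Matrix (Fin d) (Fin d) ℕ) : ℕ :=
  sInf {k | ∃ i j : Fin d, (j : ℕ) + 1 = d ∧ M i j ≠ 0 ∧ k = (i : ℕ) + 1}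

/-- Increase by one the entry in row `a` (counted from `0`) and the last column. -/
def amIncrease {d : ℕ} (M : Matrix (Fin d) (Fin d) ℕ) (a : ℕ) : Matrix (Fin d) (Fin d) ℕ :=
  fun i j => M i j + if (i : ℕ) = a ∧ (j : ℕ) + 1 = d then 1 else 0

/-- Append a zero row and a zero column, and put `1` in the new diagonal entry. -/
def amAppend {d : ℕ} (M : Matrix (Fin d) (Fin d) ℕ) : Matrix (Fin (d + 1)) (Fin (d + 1)) ℕ :=
  fun i j => Fin.lastCases (motive := fun _ => ℕ)
    (if j = Fin.last d then 1 else 0)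
    (fun i' => Fin.lastCases (motive := fun _ => ℕ) 0 (fun j' => M i' j') j) i

/-- Insert a new row and a new column, both with index `p` (counted from `0`). The new row is zero
but for a `1` in the last column; the entries of the last column that lie above the new row are moved
to the new column; the other entries of the new column are zero. -/
def amInsert {d : ℕ} (M : Matrix (Fin d) (Fin d) ℕ) (p : Fin (d + 1)) :
    Matrix (Fin (d + 1)) (Fin (d + 1)) ℕ :=
  Fin.insertNth (α := fun _ => Fin (d + 1) → ℕ) p
    (fun j => if j = Fin.last d then 1 else 0)
    (fun i => Fin.insertNth (α := fun _ => ℕ) p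
      (if (i : ℕ) < p then ∑ j : Fin d, (if (j : ℕ) + 1 = d then M i j else 0) else 0)
      (fun j => if (j : ℕ) + 1 = d ∧ (i : ℕ) < p then 0 else M i j))

/-- One step of the construction, with next entry `a`, in the three cases `a < mindex`, `a = dim` and
`mindex ≤ a < dim` (no other case occurs for an ascent sequence). -/
noncomputable def amStep (M : SqMat) (a : ℕ) : SqMat :=
  if a < mindex M.2 then ⟨M.1, amIncrease M.2 a⟩
  else if a = M.1 then ⟨M.1 + 1, amAppend M.2⟩
  else ⟨M.1 + 1, amInsert M.2 (Fin.ofNat (M.1 + 1) a)⟩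

/-- The map from ascent sequences to matrices. The first step, from the `0 × 0` matrix with
entry `0`, gives the `1 × 1` matrix `(1)`. -/
noncomputable def fAM : {n : ℕ} → (Fin n → ℕ) → SqMat
  | 0, _ => ⟨0, 0⟩
  | _ + 1, a => amStep (fAM (Fin.init a)) (a (Fin.last _))

/-! ### From ascent sequences to permutations

A permutation `π` of `Fin n` stands for the word `π 0, π 1, ..., π (n - 1)`, with all values one less
than on paper. -/

/-- The site of `π` that is preceded by exactly `s` letters is active: it is the first or the last
site, or the letter `π_s` just before it is the smallest letter, or the letter `π_s - 1` occurs to the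
left of `π_s`. -/
def IsActive {n : ℕ} (π : Equiv.Perm (Fin n)) (s : ℕ) : Prop :=
  s = 0 ∨ s = n ∨ ∃ q : Fin n, (q : ℕ) + 1 = s ∧
    ((π q : ℕ) = 0 ∨ ∃ t : Fin n, t < q ∧ (π t : ℕ) + 1 = (π q : ℕ))

/-- Insert a new largest letter into the word `π`, so that it gets position `p`. -/
def insertMax {n : ℕ} (π : Equiv.Perm (Fin n)) (p : Fin (n + 1)) : Equiv.Perm (Fin (n + 1)) :=
  (finSuccEquiv' p).trans ((Equiv.optionCongr π).trans (finSuccEquiv' (Fin.last n)).symm)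

/-- The map from ascent sequences to permutations: insert the letters in increasing order, each
one at the active site whose label is the corresponding entry, where active sites are labelled
`0, 1, 2, ...` from left to right. -/
noncomputable def fAS : {n : ℕ} → (Fin n → ℕ) → Equiv.Perm (Fin n)
  | 0, _ => 1
  | n + 1, a =>
    insertMax (fAS (Fin.init a))
      (Fin.ofNat (n + 1) (Nat.nth (IsActive (fAS (Fin.init a))) (a (Fin.last n))))

/-- The permutations of length `n` that avoid the pattern `231`. -/
def CPerms (n : ℕ) : Set (Equiv.Perm (Fin n)) := {π | ¬ ContainsPattern π ![2, 3, 1]}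

end Fishburn

namespace Fishburn

/-! Everything is read off from one family of intervals. In a 101-avoiding word the ascent bound
says exactly that each entry is at most one more than the preceding maximum, so the objects are the
101-avoiding restricted growth functions (`mem_CAsc_iff`). Attach to position k the interval from
a_k to the running maximum M_k. Every number below the number of values is then both a left and a
right endpoint (`isIntervals_of_mem_CAsc`).

An admissible next entry is either a new maximum or at most every entry since the last new maximum
(`Allowed.le_of_runMax`), so the third case of the poset and matrix constructions never occurs. By
induction the poset is the interval order of these intervals (`labelledAP_eq`) and the matrix counts
the pairs (a_k, M_k) (`fAM_eq`).

In general, (2+2)-free orders and Fishburn matrices are both such reduced interval families up to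
rearrangement (`exists_eq_before`, `exists_intervals`, `exists_perm_of_matOf_eq`), which gives (b).
N-freeness and SE-freeness both forbid l x < l y ≤ u x < u y (`IsIntervals.free_nPoset_iff`,
`seFree_iff`). For (d), sorting by right endpoint up, left endpoint down, recovers the word as the
list of left endpoints. Then (a) follows from (b), (d) and `fPM_fAP`.

For (c), a new largest letter keeps 231-avoidance exactly at sites whose left letters are all
smaller than their right letters. Labels of these sites obey the same recursion as the admissible
next entries (`fAS_spec`). -/

/-! ### Restricted growth functions -/

/-- Restricted growth functions: every entry is preceded by all smaller values. -/
def IsRGF {n : ℕ} (a : Fin n → ℕ) : Prop := ∀ k, ∀ v < a k, ∃ j < k, a j = v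

/-- Avoidance of `101`, spelled out. -/
def Avoids101 {n : ℕ} (a : Fin n → ℕ) : Prop :=
  ∀ i j k, i < j → j < k → a i = a k → a i ≤ a j

/-- The maximum of the entries up to `k`. -/
def runMax {n : ℕ} (a : Fin n → ℕ) (k : Fin n) : ℕ := (Finset.Iic k).sup a

/-- One more than the maximal entry, and `0` for the empty word. -/
def numVals {n : ℕ} (a : Fin n → ℕ) : ℕ := Finset.univ.sup fun k => a k + 1

theorem containsPattern_three_iff {n : ℕ} {α β : Type*} [LinearOrder α] [LinearOrder β]
    (a : Fin n → α) (p : Fin 3 → β) : ContainsPattern a p ↔ ∃ i j k, i < j ∧ j < k ∧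
      ∀ x y, a (![i, j, k] x) < a (![i, j, k] y) ↔ p x < p y := by
  constructor
  · rintro ⟨e, he⟩
    refine ⟨e 0, e 1, e 2, by simp, by simp, fun x y => ?_⟩
    have : ∀ x, ![e 0, e 1, e 2] x = e x := fun x => by fin_cases x <;> rfl
    rw [this, this, he]
  · rintro ⟨i, j, k, hij, hjk, h⟩
    have hm : StrictMono ![i, j, k] := by
      intro x y hxy
      have hik := hij.trans hjk
      fin_cases x <;> fin_cases y <;> simp_all
    exact ⟨OrderEmbedding.ofStrictMono _ hm, h⟩

theorem containsPattern_101_iff {n : ℕ} (a : Fin n → ℕ) :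
    ContainsPattern a ![1, 0, 1] ↔ ¬ Avoids101 a := by
  rw [containsPattern_three_iff, Avoids101]
  push Not
  refine exists_congr fun i => exists_congr fun j => exists_congr fun k => ?_
  refine and_congr_right fun _ => and_congr_right fun _ => ?_
  simp [Fin.forall_fin_succ]
  omega

/-! ### Number of values, running maxima and first occurrences -/

theorem lt_numVals {n : ℕ} (a : Fin n → ℕ) (k : Fin n) : a k < numVals a :=
  Finset.le_sup (f := fun k => a k + 1) (Finset.mem_univ k)

theorem numVals_of_isEmpty (a : Fin 0 → ℕ) : numVals a = 0 := rfl

theorem numVals_le {n : ℕ} {a : Fin n → ℕ} {m : ℕ} (h : ∀ k, a k < m) : numVals a ≤ m :=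
  Finset.sup_le fun k _ => h k

theorem le_runMax {n : ℕ} (a : Fin n → ℕ) {j k : Fin n} (h : j ≤ k) : a j ≤ runMax a k :=
  Finset.le_sup (by simpa using h)

theorem runMax_le {n : ℕ} {a : Fin n → ℕ} {k : Fin n} {m : ℕ} (h : ∀ j ≤ k, a j ≤ m) :
    runMax a k ≤ m :=
  Finset.sup_le fun j hj => h j (by simpa using hj)

theorem runMax_mono {n : ℕ} (a : Fin n → ℕ) : Monotone (runMax a) := fun _ _ h =>
  runMax_le fun _ hj => le_runMax a (hj.trans h)

theorem exists_eq_runMax {n : ℕ} (a : Fin n → ℕ) (k : Fin n) : ∃ j ≤ k, a j = runMax a k := by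
  obtain ⟨j, hj, h⟩ := Finset.exists_mem_eq_sup (Finset.Iic k) ⟨k, by simp⟩ a
  exact ⟨j, by simpa using hj, h.symm⟩

theorem runMax_lt_numVals {n : ℕ} (a : Fin n → ℕ) (k : Fin n) : runMax a k < numVals a := by
  obtain ⟨j, -, hj⟩ := exists_eq_runMax a k
  exact hj ▸ lt_numVals a j

theorem exists_succ_eq_numVals {n : ℕ} (a : Fin n → ℕ) (h : 0 < numVals a) :
    ∃ k, a k + 1 = numVals a := by
  by_contra! hc
  have := numVals_le (a := a) (m := numVals a - 1) fun k => by
    have := lt_numVals a k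
    have := hc k
    omega
  omega

theorem IsRGF.exists_eq_of_le {n : ℕ} {a : Fin n → ℕ} (h : IsRGF a) {k : Fin n} {v : ℕ}
    (hv : v ≤ a k) : ∃ j ≤ k, a j = v := by
  rcases hv.lt_or_eq with hv | rfl
  · obtain ⟨j, hj, e⟩ := h k v hv
    exact ⟨j, hj.le, e⟩
  · exact ⟨k, le_rfl, rfl⟩

theorem IsRGF.exists_eq_of_le_runMax {n : ℕ} {a : Fin n → ℕ} (h : IsRGF a) {k : Fin n} {v : ℕ}
    (hv : v ≤ runMax a k) : ∃ j ≤ k, a j = v := by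
  obtain ⟨j, hj, e⟩ := exists_eq_runMax a k
  obtain ⟨i, hi, e'⟩ := h.exists_eq_of_le (e ▸ hv)
  exact ⟨i, hi.trans hj, e'⟩

theorem IsRGF.exists_eq_of_lt_numVals {n : ℕ} {a : Fin n → ℕ} (h : IsRGF a) {v : ℕ}
    (hv : v < numVals a) : ∃ j, a j = v := by
  obtain ⟨k, hk⟩ := exists_succ_eq_numVals a (by omega)
  obtain ⟨j, -, e⟩ := h.exists_eq_of_le (k := k) (v := v) (by omega)
  exact ⟨j, e⟩

/-- Every value below `numVals a` has a first occurrence, where it is a record. -/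
theorem IsRGF.exists_record {n : ℕ} {a : Fin n → ℕ} (h : IsRGF a) {v : ℕ}
    (hv : v < numVals a) : ∃ j, a j = v ∧ runMax a j = v ∧ ∀ i < j, a i < v := by
  classical
  obtain ⟨j, hj⟩ := h.exists_eq_of_lt_numVals hv
  obtain ⟨j, hj, hmin⟩ := WellFounded.has_min (wellFounded_lt (α := Fin n)) {j | a j = v} ⟨j, hj⟩
  have hj : a j = v := hj
  have hlt : ∀ i < j, a i < v := by
    intro i hi
    by_contra! hc
    -- An earlier entry that is at least v would force a still earlier occurrence of v.
    obtain ⟨i', hi', e⟩ := h.exists_eq_of_le hc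
    exact hmin i' e (hi'.trans_lt hi)
  refine ⟨j, hj, le_antisymm (runMax_le fun i hi => ?_) (hj ▸ le_runMax a le_rfl), hlt⟩
  rcases hi.lt_or_eq with hi | rfl
  · exact (hlt i hi).le
  · exact hj.le

/-- The first occurrence of a positive value exceeds everything before it, so it is the top of an
ascent; different values give different ascents. -/
theorem IsRGF.le_asc {n : ℕ} {a : Fin n → ℕ} (h : IsRGF a) : numVals a ≤ asc a + 1 := by
  rw [asc]
  -- An ascent is sent to its top minus one, so v comes from the first occurrence of v + 1; the
  -- default 0 is never needed.
  have hsub : Set.Iio (numVals a - 1) ⊆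
      (fun i : Fin n => if hi : (i : ℕ) + 1 < n then a ⟨i + 1, hi⟩ - 1 else 0) ''
        {i : Fin n | ∃ j : Fin n, (j : ℕ) = (i : ℕ) + 1 ∧ a i < a j} := by
    intro v hv
    have hv : v < numVals a - 1 := hv
    obtain ⟨j, hj, -, hlt⟩ := h.exists_record (v := v + 1) (by omega)
    have hj0 : (j : ℕ) ≠ 0 := by
      intro h0
      obtain ⟨i, hi, -⟩ := h j v (by omega)
      have : (i : ℕ) < j := hi
      omega
    have hjn := j.isLt
    refine ⟨⟨j - 1, by omega⟩, ⟨j, by simp; omega, ?_⟩, ?_⟩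
    · rw [hj]
      exact hlt _ (Fin.lt_def.2 (by simp; omega))
    · have e : (j : ℕ) - 1 + 1 = j := by omega
      simp [e, hj]
  have h1 := Set.ncard_le_ncard hsub
  have h2 := h1.trans (Set.ncard_image_le (Set.toFinite _))
  rw [← Finset.coe_Iio, Set.ncard_coe_finset, Nat.card_Iio] at h2
  omega

/-- An ascent top is the first occurrence of its value, since an earlier copy followed by the ascent
bottom would be a 101. Ascents thus inject into the positive values. The empty word has no values
and must be excluded. -/
theorem Avoids101.asc_lt {n : ℕ} {a : Fin n → ℕ} (h' : Avoids101 a) (hn : 0 < n) :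
    asc a < numVals a := by
  have hpos : 0 < numVals a := (Nat.zero_le _).trans_lt (lt_numVals a ⟨0, hn⟩)
  suffices asc a ≤ numVals a - 1 by omega
  rw [asc]
  have hfirst : ∀ i j k : Fin n, (j : ℕ) = i + 1 → a i < a j → k < j → a k ≠ a j := by
    intro i j k h1 h2 h3 h4
    have : (k : ℕ) < j := h3
    have hki : k ≠ i := by rintro rfl; omega
    have hki' : (k : ℕ) ≠ i := fun h => hki (Fin.ext h)
    have := h' k i j (Fin.lt_def.2 (by omega)) (Fin.lt_def.2 (by omega)) h4
    omega
  have := Set.ncard_le_ncard_of_injOn (t := Set.Ioo 0 (numVals a))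
    (fun i : Fin n => if hi : (i : ℕ) + 1 < n then a ⟨i + 1, hi⟩ else 0)
    (s := {i : Fin n | ∃ j : Fin n, (j : ℕ) = (i : ℕ) + 1 ∧ a i < a j}) ?_ ?_ (Set.finite_Ioo _ _)
  · rw [← Finset.coe_Ioo, Set.ncard_coe_finset, Nat.card_Ioo] at this
    omega
  · rintro i ⟨j, hj, hij⟩
    have hjn := j.isLt
    have e : (⟨(i : ℕ) + 1, by omega⟩ : Fin n) = j := Fin.ext hj.symm
    have := lt_numVals a j
    simp [← hj, this]
    omega
  · rintro i ⟨j, hj, hij⟩ i' ⟨j', hj', hij'⟩ heq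
    have hjn := j.isLt
    have hjn' := j'.isLt
    simp [← hj, ← hj'] at heq
    rcases lt_trichotomy j j' with hlt | rfl | hlt
    · exact absurd heq (hfirst i' j' j hj' hij' hlt)
    · exact Fin.ext (by omega)
    · exact absurd heq.symm (hfirst i j j' hj hij hlt)

theorem IsRGF.castLE {m n : ℕ} {a : Fin n → ℕ} (h : IsRGF a) (hmn : m ≤ n) :
    IsRGF fun j : Fin m => a (Fin.castLE hmn j) := by
  intro k v hv
  obtain ⟨j, hj, e⟩ := h _ v hv
  have hj : (j : ℕ) < k := hj
  exact ⟨⟨j, by omega⟩, hj, e⟩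

theorem Avoids101.castLE {m n : ℕ} {a : Fin n → ℕ} (h : Avoids101 a) (hmn : m ≤ n) :
    Avoids101 fun j : Fin m => a (Fin.castLE hmn j) :=
  fun _ _ _ h1 h2 h3 => h _ _ _ h1 h2 h3

/-- On every nonempty 101-avoiding restricted growth prefix the number of ascents plus one is
`numVals`, so the two bounds on the next entry agree; strong induction supplies the growth property
of the prefix. -/
theorem mem_CAsc_iff {n : ℕ} {a : Fin n → ℕ} : a ∈ CAsc n ↔ IsRGF a ∧ Avoids101 a := by
  simp only [CAsc, Set.mem_ofPred_eq, containsPattern_101_iff, not_not, and_congr_left_iff]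
  intro hav
  constructor
  · intro ha k
    induction k using WellFoundedLT.induction with
    | ind k ih =>
      intro v hv
      rcases Nat.eq_zero_or_pos k with h0 | h0
      · have := (ha k).1 h0
        omega
      · have hr : IsRGF fun j : Fin k => a (Fin.castLE k.isLt.le j) := by
          intro j w hw
          obtain ⟨i, hi, e⟩ := ih (Fin.castLE k.isLt.le j) (Fin.lt_def.2 j.isLt) w hw
          have hi : (i : ℕ) < j := hi
          exact ⟨⟨i, by omega⟩, hi, e⟩
        have h1 := (ha k).2 h0
        have h2 := (hav.castLE k.isLt.le).asc_lt h0
        obtain ⟨j, hj⟩ := hr.exists_eq_of_lt_numVals (v := v) (by omega)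
        exact ⟨_, Fin.lt_def.2 j.isLt, hj⟩
  · intro h k
    constructor
    · intro h0
      by_contra hc
      obtain ⟨j, hj, -⟩ := h k 0 (by omega)
      have : (j : ℕ) < k := hj
      omega
    · intro h0
      refine le_trans ?_ (h.castLE k.isLt.le).le_asc
      by_contra! hc
      obtain ⟨j, hj, e⟩ := h k _ hc
      have hj : (j : ℕ) < k := hj
      have := lt_numVals (fun j : Fin k => a (Fin.castLE k.isLt.le j)) ⟨j, hj⟩
      exact absurd e this.ne

/-! ### Extending a sequence by one entry -/

theorem IsRGF.init {n : ℕ} {a : Fin (n + 1) → ℕ} (h : IsRGF a) : IsRGF (Fin.init a) :=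
  h.castLE (Nat.le_succ n)

theorem Avoids101.init {n : ℕ} {a : Fin (n + 1) → ℕ} (h : Avoids101 a) : Avoids101 (Fin.init a) :=
  h.castLE (Nat.le_succ n)

theorem numVals_eq_max {n : ℕ} (a : Fin (n + 1) → ℕ) :
    numVals a = max (numVals (Fin.init a)) (a (Fin.last n) + 1) := by
  apply le_antisymm
  · refine numVals_le fun k => ?_
    induction k using Fin.lastCases with
    | last => simp
    | cast k => exact lt_max_of_lt_left (lt_numVals (Fin.init a) k)
  · exact max_le (numVals_le fun k => lt_numVals a k.castSucc) (lt_numVals a _)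

theorem isRGF_succ_iff {n : ℕ} {a : Fin (n + 1) → ℕ} :
    IsRGF a ↔ IsRGF (Fin.init a) ∧ a (Fin.last n) ≤ numVals (Fin.init a) := by
  constructor
  · intro h
    refine ⟨h.init, ?_⟩
    by_contra! hc
    obtain ⟨j, hj, e⟩ := h _ _ hc
    have := lt_numVals (Fin.init a) (j.castPred hj.ne)
    simp [Fin.init, e] at this
  · rintro ⟨h, hl⟩ k v hv
    induction k using Fin.lastCases with
    | last =>
      obtain ⟨j, e⟩ := h.exists_eq_of_lt_numVals (hv.trans_le hl)
      exact ⟨j.castSucc, Fin.castSucc_lt_last j, e⟩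
    | cast k =>
      obtain ⟨j, hj, e⟩ := h k v hv
      exact ⟨j.castSucc, by simpa using hj, e⟩

/-- `v` may follow the `101`-avoiding ascent sequence `a`. -/
def Allowed {n : ℕ} (a : Fin n → ℕ) (v : ℕ) : Prop :=
  v ≤ numVals a ∧ ∀ i j, i < j → a i = v → v ≤ a j

theorem mem_CAsc_succ_iff {n : ℕ} {a : Fin (n + 1) → ℕ} :
    a ∈ CAsc (n + 1) ↔ Fin.init a ∈ CAsc n ∧ Allowed (Fin.init a) (a (Fin.last n)) := by
  simp only [mem_CAsc_iff, isRGF_succ_iff, Allowed]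
  constructor
  · rintro ⟨⟨h1, h2⟩, h3⟩
    refine ⟨⟨h1, h3.init⟩, h2, fun i j hij e => ?_⟩
    have := h3 i.castSucc j.castSucc (Fin.last n) (by simpa using hij) (Fin.castSucc_lt_last j) e
    exact e ▸ this
  · rintro ⟨⟨h1, h3⟩, h2, h4⟩
    refine ⟨⟨h1, h2⟩, fun i j k hij hjk e => ?_⟩
    have hj : j ≠ Fin.last n := (hjk.trans_le (Fin.le_last k)).ne
    have hi : i ≠ Fin.last n := (hij.trans_le (Fin.le_last j)).ne
    obtain ⟨j, rfl⟩ := Fin.exists_castSucc_eq.2 hj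
    obtain ⟨i, rfl⟩ := Fin.exists_castSucc_eq.2 hi
    induction k using Fin.lastCases with
    | last => exact e ▸ h4 i j (by simpa using hij) e
    | cast k => exact h3 i j k (by simpa using hij) (by simpa using hjk) e

/-- Any old value above the last entry now sits above a later smaller entry, hence is forbidden; a
fresh maximum is always possible. `isSplit_insertMax_iff` is the same recursion for sites of
permutations. -/
theorem allowed_succ_iff {n : ℕ} {a : Fin (n + 1) → ℕ} (ha : a ∈ CAsc (n + 1)) (w : ℕ) :
    Allowed a w ↔ (Allowed (Fin.init a) w ∧ w ≤ a (Fin.last n)) ∨ w = numVals a := by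
  obtain ⟨hb, hv⟩ := mem_CAsc_succ_iff.1 ha
  have hmax := numVals_eq_max a
  have hv1 := hv.1
  constructor
  · rintro ⟨h1, h2⟩
    rcases h1.lt_or_eq with h1 | h1
    · left
      have hle : w ≤ a (Fin.last n) := by
        rcases hv1.lt_or_eq with h3 | h3
        · obtain ⟨j, e⟩ := (mem_CAsc_iff.1 hb).1.exists_eq_of_lt_numVals (v := w) (by omega)
          exact h2 j.castSucc (Fin.last n) (Fin.castSucc_lt_last j) e
        · omega
      exact ⟨⟨by omega, fun i j hij e => h2 i.castSucc j.castSucc (by simpa using hij) e⟩, hle⟩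
    · exact Or.inr h1
  · rintro (⟨h1, h2⟩ | rfl)
    · refine ⟨by have := h1.1; omega, fun i j hij e => ?_⟩
      obtain ⟨i, rfl⟩ := Fin.exists_castSucc_eq.2 (hij.trans_le (Fin.le_last j)).ne
      induction j using Fin.lastCases with
      | last => exact h2
      | cast j => exact h1.2 i j (by simpa using hij) e
    · exact ⟨le_rfl, fun i j hij e => absurd e (lt_numVals a i).ne⟩

theorem runMax_castSucc {n : ℕ} (a : Fin (n + 1) → ℕ) (k : Fin n) :
    runMax a k.castSucc = runMax (Fin.init a) k := by
  apply le_antisymm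
  · refine runMax_le fun j hj => ?_
    obtain ⟨j, rfl⟩ := Fin.exists_castSucc_eq.2 (hj.trans_lt (Fin.castSucc_lt_last k)).ne
    exact le_runMax (Fin.init a) (by simpa using hj)
  · exact runMax_le fun j hj => le_runMax a (by simpa using hj)

theorem runMax_last {n : ℕ} (a : Fin (n + 1) → ℕ) : runMax a (Fin.last n) + 1 = numVals a := by
  apply le_antisymm
  · exact runMax_lt_numVals a _
  · exact numVals_le fun k => Nat.lt_succ_of_le (le_runMax a (Fin.le_last k))

/-- The entries after the last new maximum are at least as large as any admissible next entry that
is not a new maximum. -/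
theorem Allowed.le_of_runMax {n : ℕ} {a : Fin n → ℕ} (ha : IsRGF a) {v : ℕ} (hv : Allowed a v)
    (hlt : v < numVals a) {k : Fin n} (hk : runMax a k + 1 = numVals a) : v ≤ a k := by
  obtain ⟨j, hj, e⟩ := ha.exists_eq_of_le_runMax (k := k) (v := v) (by omega)
  rcases hj.lt_or_eq with hj | rfl
  · exact hv.2 j k hj e
  · exact e.ge

/-- Between two new maxima the entries decrease weakly. -/
theorem monotone_runMax_pair {n : ℕ} {a : Fin n → ℕ} (ha : IsRGF a) (ha' : Avoids101 a) :
    Monotone fun k => toLex (runMax a k, OrderDual.toDual (a k)) := by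
  intro i j hij
  rw [Prod.Lex.toLex_le_toLex]
  rcases (runMax_mono a hij).lt_or_eq with h | h
  · exact Or.inl h
  · refine Or.inr ⟨h, ?_⟩
    rw [OrderDual.toDual_le_toDual]
    rcases hij.lt_or_eq with hij | rfl
    · obtain ⟨k, hk, e⟩ := ha.exists_eq_of_le_runMax (k := i) (h ▸ le_runMax a (le_refl j))
      rcases hk.lt_or_eq with hk | rfl
      · exact e ▸ ha' k i j hk hij e
      · exact e.ge
    · exact le_rfl

/-! ### Matrices of pair statistics -/

/-- The `d × d` matrix with entries `f i j`. -/
def matOf (d : ℕ) (f : ℕ → ℕ → ℕ) : SqMat := ⟨d, fun i j => f i j⟩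

/-- Entries indexed by all of ℕ make sense in every dimension, so matrices whose dimensions are only
provably equal are compared without casts. -/
theorem matOf_congr {d d' : ℕ} {f g : ℕ → ℕ → ℕ} (h : d = d')
    (hfg : ∀ i < d, ∀ j < d, f i j = g i j) : matOf d f = matOf d' g := by
  subst h
  exact congrArg (Sigma.mk d) (funext fun i => funext fun j => hfg i i.isLt j j.isLt)

theorem eq_of_matOf_eq {d d' : ℕ} {f g : ℕ → ℕ → ℕ} (h : matOf d f = matOf d' g) :
    d = d' ∧ ∀ i < d, ∀ j < d, f i j = g i j := by
  obtain rfl : d = d' := congrArg Sigma.fst h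
  refine ⟨rfl, fun i hi j hj => ?_⟩
  exact congrFun (congrFun (eq_of_heq (Sigma.mk.inj h).2) ⟨i, hi⟩) ⟨j, hj⟩

/-- The number of indices at which the pair `(l, u)` takes the value `(i, j)`. -/
noncomputable def pairCount {n : ℕ} (l u : Fin n → ℕ) (i j : ℕ) : ℕ :=
  Set.ncard {x | l x = i ∧ u x = j}

theorem pairCount_ne_zero {n : ℕ} {l u : Fin n → ℕ} {i j : ℕ} :
    pairCount l u i j ≠ 0 ↔ ∃ x, l x = i ∧ u x = j := by
  rw [pairCount, Ne, Set.ncard_eq_zero]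
  exact Set.nonempty_iff_ne_empty.symm

/-- The intervals `[l x, u x]` have endpoints below `d`, and every number below `d` is both a left and
a right endpoint. -/
structure IsIntervals {n : ℕ} (d : ℕ) (l u : Fin n → ℕ) : Prop where
  le : ∀ x, l x ≤ u x
  lt : ∀ x, u x < d
  surj_l : ∀ v < d, ∃ x, l x = v
  surj_u : ∀ v < d, ∃ x, u x = v

/-- The interval order of the intervals `[l x, u x]`. -/
def before {n : ℕ} (l u : Fin n → ℕ) (x y : Fin n) : Prop := u x < l y

variable {n d : ℕ} {l u : Fin n → ℕ}

theorem IsIntervals.l_lt (h : IsIntervals d l u) (x : Fin n) : l x < d :=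
  (h.le x).trans_lt (h.lt x)

theorem IsIntervals.pos (h : IsIntervals d l u) (hn : 0 < n) : 0 < d :=
  (Nat.zero_le _).trans_lt (h.lt ⟨0, hn⟩)

theorem IsIntervals.mem_matrices (h : IsIntervals d l u) : matOf d (pairCount l u) ∈ Matrices n := by
  classical
  refine ⟨fun i j hij => ?_, fun i => ?_, fun j => ?_, ?_⟩
  · by_contra hc
    obtain ⟨x, hx, hx'⟩ := pairCount_ne_zero.1 hc
    have := h.le x
    have : (j : ℕ) < i := hij
    omega
  · obtain ⟨x, hx⟩ := h.surj_l i i.isLt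
    exact ⟨⟨u x, h.lt x⟩, pairCount_ne_zero.2 ⟨x, hx, rfl⟩⟩
  · obtain ⟨x, hx⟩ := h.surj_u j j.isLt
    exact ⟨⟨l x, h.l_lt x⟩, pairCount_ne_zero.2 ⟨x, rfl, hx⟩⟩
  · change ∑ i : Fin d, ∑ j : Fin d, pairCount l u i j = n
    rw [← Fintype.sum_prod_type' (f := fun i j : Fin d => pairCount l u i j)]
    have := Finset.card_eq_sum_card_fiberwise (s := (Finset.univ : Finset (Fin n)))
      (t := (Finset.univ : Finset (Fin d × Fin d)))
      (f := fun x => (⟨l x, h.l_lt x⟩, ⟨u x, h.lt x⟩)) (fun _ _ => Finset.mem_coe.2 (Finset.mem_univ _))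
    rw [Finset.card_univ, Fintype.card_fin] at this
    refine Eq.trans (Finset.sum_congr rfl fun p _ => ?_) this.symm
    rw [pairCount, ← Set.ncard_coe_finset]
    congr 1
    ext x
    simp [Prod.ext_iff, Fin.ext_iff]

/-- An SE pair of nonzero entries is a pair of intervals that overlap with neither endpoint shared
and neither containing the other. -/
theorem seFree_iff (h : IsIntervals d l u) : SEFree (matOf d (pairCount l u)) ↔
    ¬ ∃ x y, l x < l y ∧ u x < u y ∧ l y ≤ u x := by
  rw [SEFree, not_iff_not]
  constructor
  · rintro ⟨i, j, i', j', h1, h2, h3, h4, h5⟩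
    obtain ⟨x, hx, hx'⟩ := pairCount_ne_zero.1 h1
    obtain ⟨y, hy, hy'⟩ := pairCount_ne_zero.1 h2
    refine ⟨x, y, ?_, ?_, ?_⟩
    · rw [hx, hy]; exact h3
    · rw [hx', hy']; exact h4
    · rw [hx', hy]; exact h5
  · rintro ⟨x, y, h1, h2, h3⟩
    exact ⟨⟨l x, h.l_lt x⟩, ⟨u x, h.lt x⟩, ⟨l y, h.l_lt y⟩, ⟨u y, h.lt y⟩,
      pairCount_ne_zero.2 ⟨x, rfl, rfl⟩, pairCount_ne_zero.2 ⟨y, rfl, rfl⟩, h1, h2, h3⟩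

/-- In an SE-free Fishburn matrix the diagonal entries are nonzero. -/
theorem IsIntervals.exists_diag (h : IsIntervals d l u)
    (hse : ¬ ∃ x y, l x < l y ∧ u x < u y ∧ l y ≤ u x) {v : ℕ} (hv : v < d) :
    ∃ x, l x = v ∧ u x = v := by
  obtain ⟨x, hx⟩ := h.surj_l v hv
  obtain ⟨y, hy⟩ := h.surj_u v hv
  have h1 := h.le x
  have h2 := h.le y
  by_contra! hc
  have h3 := hc x hx
  have h4 : l y ≠ v := fun h => hc y h hy
  -- Otherwise y starts before v and ends there, while x starts at v and ends later: a forbidden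
  -- overlap.
  exact hse ⟨y, x, by omega, by omega, by omega⟩

/-- Every Fishburn matrix counts the pairs of a sequence of intervals, which can be taken sorted by
increasing right and decreasing left endpoints. -/
theorem exists_intervals {n : ℕ} {M : SqMat} (hM : M ∈ Matrices n) : ∃ l u : Fin n → ℕ,
    IsIntervals M.1 l u ∧ M = matOf M.1 (pairCount l u) ∧
      Monotone fun k => toLex (u k, OrderDual.toDual (l k)) := by
  classical
  obtain ⟨d, M⟩ := M
  obtain ⟨h1, h2, h3, h4⟩ := hM
  dsimp only at h1 h2 h3 h4 ⊢
  -- Each entry m contributes m cells, so there are n cells in all; a cell's row and column are the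
  -- endpoints of its interval.
  have hcard : Fintype.card (Σ p : Fin d × Fin d, Fin (M p.1 p.2)) = n := by
    rw [Fintype.card_sigma, ← h4, ← Fintype.sum_prod_type' (f := fun i j => M i j)]
    simp
  let e := (Fintype.equivFinOfCardEq hcard).symm
  let f : Fin n → ℕ ×ₗ ℕᵒᵈ := fun k => toLex ((e k).1.2, OrderDual.toDual ((e k).1.1 : ℕ))
  let e' := (Tuple.sort f).trans e
  have hcount : ∀ p : Fin d × Fin d, Set.ncard {x | (e' x).1 = p} = M p.1 p.2 := by
    intro p
    rw [← Set.ncard_image_of_injective _ e'.injective]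
    have : e' '' {x | (e' x).1 = p} = Set.range (Sigma.mk p) := by
      ext ⟨q, z⟩
      constructor
      · rintro ⟨x, hx, hx'⟩
        have hx : (e' x).1 = p := hx
        rw [hx'] at hx
        subst hx
        exact ⟨z, rfl⟩
      · rintro ⟨w, hw⟩
        refine ⟨e'.symm ⟨q, z⟩, ?_, by simp⟩
        have : p = q := congrArg Sigma.fst hw
        simp [this]
    rw [this, ← Set.image_univ, Set.ncard_image_of_injective _ sigma_mk_injective, Set.ncard_univ]
    simp
  have hex : ∀ i j, M i j ≠ 0 ↔ ∃ x, (e' x).1 = (i, j) := by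
    intro i j
    rw [← hcount (i, j), Ne, Set.ncard_eq_zero]
    exact Set.nonempty_iff_ne_empty.symm
  refine ⟨fun x => (e' x).1.1, fun x => (e' x).1.2, ⟨fun x => ?_, fun x => (e' x).1.2.isLt,
    fun v hv => ?_, fun v hv => ?_⟩, ?_, Tuple.monotone_sort f⟩
  · by_contra! hc
    exact (hex _ _).2 ⟨x, rfl⟩ (h1 _ _ hc)
  · obtain ⟨j, hj⟩ := h2 ⟨v, hv⟩
    obtain ⟨x, hx⟩ := (hex _ _).1 hj
    exact ⟨x, by simp [hx]⟩
  · obtain ⟨j, hj⟩ := h3 ⟨v, hv⟩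
    obtain ⟨x, hx⟩ := (hex _ _).1 hj
    exact ⟨x, by simp [hx]⟩
  · refine congrArg (Sigma.mk d) (funext fun i => funext fun j => ?_)
    rw [← hcount (i, j), pairCount]
    congr 1
    ext x
    simp [Prod.ext_iff, Fin.ext_iff]

/-- Sequences of intervals with the same matrix are rearrangements of each other. -/
theorem exists_perm_of_matOf_eq {d' : ℕ} {l' u' : Fin n → ℕ} (h : IsIntervals d l u)
    (h' : IsIntervals d' l' u') (e : matOf d (pairCount l u) = matOf d' (pairCount l' u')) :
    ∃ σ : Equiv.Perm (Fin n), ∀ x, l' (σ x) = l x ∧ u' (σ x) = u x := by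
  classical
  obtain ⟨rfl, e1⟩ := eq_of_matOf_eq e
  have e2 : ∀ i j, pairCount l u i j = pairCount l' u' i j := by
    intro i j
    by_cases hij : i < d ∧ j < d
    · exact e1 i hij.1 j hij.2
    · have z1 : ¬ pairCount l u i j ≠ 0 := fun hc => hij <| by
        obtain ⟨x, rfl, rfl⟩ := pairCount_ne_zero.1 hc
        exact ⟨h.l_lt x, h.lt x⟩
      have z2 : ¬ pairCount l' u' i j ≠ 0 := fun hc => hij <| by
        obtain ⟨x, rfl, rfl⟩ := pairCount_ne_zero.1 hc
        exact ⟨h'.l_lt x, h'.lt x⟩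
      push Not at z1 z2
      rw [z1, z2]
  -- Equal counts make the fibres over each pair equinumerous; bijections of fibres glue to a
  -- permutation.
  have key : ∀ p : ℕ × ℕ, Nonempty ({x // (l x, u x) = p} ≃ {x // (l' x, u' x) = p}) := by
    intro p
    refine ⟨Fintype.equivOfCardEq ?_⟩
    have := e2 p.1 p.2
    rw [pairCount, pairCount, ← Nat.card_coe_set_eq, ← Nat.card_coe_set_eq] at this
    rw [← Nat.card_eq_fintype_card, ← Nat.card_eq_fintype_card]
    simp only [Prod.ext_iff]
    exact this
  refine ⟨Equiv.ofFiberEquiv fun p => (key p).some, fun x => ?_⟩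
  have := Equiv.ofFiberEquiv_map (f := fun x => (l x, u x)) (g := fun x => (l' x, u' x))
    (fun p => (key p).some) x
  exact Prod.ext_iff.1 this

/-! ### Levels of interval orders -/

/-- Every v < d is a right endpoint, so raising the threshold past v adds an element. The threshold
d is included because it gives the whole poset, the conventional last downset. -/
theorem IsIntervals.below_injOn (h : IsIntervals d l u) :
    Set.InjOn (fun v => {y | u y < v}) (Set.Iic d) := by
  have key : ∀ v w, v < w → w ≤ d → {y | u y < v} ≠ {y | u y < w} := by
    intro v w hvw hw he
    obtain ⟨x, hx⟩ := h.surj_u v (by omega)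
    have : x ∈ {y | u y < w} := by
      change u x < w
      omega
    rw [← he] at this
    have : u x < v := this
    omega
  intro v hv w hw he
  by_contra hne
  rcases lt_or_gt_of_ne hne with hlt | hlt
  · exact key v w hlt hw he
  · exact key w v hlt hv he.symm

theorem IsIntervals.below_ssubset_iff (h : IsIntervals d l u) {v w : ℕ} (hv : v ≤ d) (hw : w ≤ d) :
    {y | u y < v} ⊂ {y | u y < w} ↔ v < w := by
  have mono : ∀ {v w : ℕ}, v ≤ w → {y | u y < v} ⊆ {y | u y < w} :=
    fun hvw _ hy => lt_of_lt_of_le hy hvw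
  constructor
  · intro hs
    by_contra! hc
    exact hs.2 (mono hc)
  · intro hlt
    refine (mono hlt.le).ssubset_of_ne fun he => ?_
    exact hlt.ne (h.below_injOn hv hw he)

/-- Since every v < d is a left endpoint, there is one downset per threshold below d; levels are
therefore left endpoints. -/
theorem IsIntervals.range_down (h : IsIntervals d l u) :
    Set.range (down (before l u)) = (fun v => {y | u y < v}) '' Set.Iio d := by
  ext D
  constructor
  · rintro ⟨x, rfl⟩
    exact ⟨l x, h.l_lt x, rfl⟩
  · rintro ⟨v, hv, rfl⟩
    obtain ⟨x, rfl⟩ := h.surj_l v hv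
    exact ⟨x, rfl⟩

theorem IsIntervals.level_eq (h : IsIntervals d l u) (x : Fin n) : level (before l u) x = l x := by
  have : {D | D ∈ Set.range (down (before l u)) ∧ D ⊂ down (before l u) x} =
      (fun v => {y | u y < v}) '' Set.Iio (l x) := by
    rw [h.range_down]
    have hx := h.l_lt x
    ext D
    constructor
    · rintro ⟨⟨v, hv, rfl⟩, hD⟩
      exact ⟨v, (h.below_ssubset_iff (le_of_lt hv) hx.le).1 hD, rfl⟩
    · rintro ⟨v, hv, rfl⟩
      have hv : v < l x := hv
      exact ⟨⟨v, hv.trans hx, rfl⟩, (h.below_ssubset_iff (hv.trans hx).le hx.le).2 hv⟩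
  have hinj := h.below_injOn.mono fun v (hv : v ∈ Set.Iio (l x)) =>
    le_of_lt (lt_trans hv (h.l_lt x))
  rw [level, this, Set.InjOn.ncard_image hinj]
  rw [← Finset.coe_Iio, Set.ncard_coe_finset, Nat.card_Iio]

theorem IsIntervals.ell_eq (h : IsIntervals d l u) (hd : 0 < d) : ell (before l u) + 1 = d := by
  have h0 : (∅ : Set (Fin n)) = (fun v => {y | u y < v}) 0 := by simp
  have : Set.range (down (before l u)) \ {∅} = (fun v => {y | u y < v}) '' Set.Ioo 0 d := by
    rw [h.range_down]
    ext D
    constructor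
    · rintro ⟨⟨v, hv, rfl⟩, hD⟩
      refine ⟨v, ⟨Nat.pos_of_ne_zero ?_, hv⟩, rfl⟩
      rintro rfl
      exact hD h0.symm
    · rintro ⟨v, hv, rfl⟩
      refine ⟨⟨v, hv.2, rfl⟩, fun hD => ?_⟩
      rw [Set.mem_singleton_iff, h0] at hD
      exact hv.1.ne' (h.below_injOn hv.2.le (Nat.zero_le d) hD)
  have hinj := h.below_injOn.mono fun v (hv : v ∈ Set.Ioo 0 d) => hv.2.le
  rw [ell, this, Set.InjOn.ncard_image hinj, ← Finset.coe_Ioo, Set.ncard_coe_finset, Nat.card_Ioo]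
  omega

theorem IsIntervals.downAt_eq (h : IsIntervals d l u) {v : ℕ} (hv : v < d) :
    downAt (before l u) v = {y | u y < v} := by
  ext y
  constructor
  · rintro ⟨x, hx, hyx⟩
    rw [h.level_eq] at hx
    exact hx ▸ hyx
  · intro hy
    obtain ⟨x, rfl⟩ := h.surj_l v hv
    exact ⟨x, h.level_eq x, hy⟩

theorem IsIntervals.downAtExt_eq (h : IsIntervals d l u) (hd : 0 < d) {v : ℕ} (hv : v ≤ d) :
    downAtExt (before l u) v = {y | u y < v} := by
  rw [downAtExt, h.ell_eq hd]
  split_ifs with he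
  · subst he
    exact (Set.eq_univ_of_forall h.lt).symm
  · exact h.downAt_eq (lt_of_le_of_ne hv he)

/-- Level i consists of the intervals starting at i, and the difference of consecutive downsets of
those ending at j. -/
theorem IsIntervals.labelledPM_eq (h : IsIntervals d l u) (hd : 0 < d) :
    labelledPM (before l u) = matOf d (pairCount l u) := by
  refine (matOf_congr (h.ell_eq hd) fun i hi j hj => ?_ :
    matOf (ell (before l u) + 1) (fun i j => Set.ncard ({x | level (before l u) x = i} ∩
      (downAtExt (before l u) (j + 1) \ downAtExt (before l u) j))) = _)
  rw [h.ell_eq hd] at hj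
  rw [h.downAtExt_eq hd hj, h.downAtExt_eq hd hj.le, pairCount]
  congr 1
  ext x
  simp only [h.level_eq, Set.mem_inter_iff, Set.mem_ofPred_eq, Set.mem_sdiff]
  omega

theorem IsIntervals.isMaxElt_iff (h : IsIntervals d l u) (x : Fin n) :
    IsMaxElt (before l u) x ↔ u x + 1 = d := by
  constructor
  · intro hx
    have := h.lt x
    by_contra hc
    obtain ⟨y, hy⟩ := h.surj_l (u x + 1) (by omega)
    exact hx y (by simp [before, hy])
  · intro hx y hy
    have := h.l_lt y
    have : u x < l y := hy
    omega

/-! ### Interval orders without `2+2` and `N` -/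

theorem IsIntervals.isStrictOrder (h : IsIntervals d l u) : IsStrictOrder (Fin n) (before l u) where
  irrefl x hx := absurd (h.le x) (not_le.2 hx)
  trans _ y _ hxy hyz := (lt_of_lt_of_le hxy (h.le y)).trans hyz

/-- Two unrelated chains would give the cycle l₁' ≤ u₀ < l₁ ≤ u₀' < l₁'. -/
theorem before_free : Free twoPlusTwo (before l u) := by
  refine ⟨fun e => ?_⟩
  have h1 : before l u (e (.inl 0)) (e (.inl 1)) := e.map_rel_iff.2 (.inl (by simp))
  have h2 : before l u (e (.inr 0)) (e (.inr 1)) := e.map_rel_iff.2 (.inr (by simp))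
  have h3 : ¬ before l u (e (.inl 0)) (e (.inr 1)) := fun h => by
    cases (e.map_rel_iff.1 h : Sum.LiftRel _ _ _ _)
  have h4 : ¬ before l u (e (.inr 0)) (e (.inl 1)) := fun h => by
    cases (e.map_rel_iff.1 h : Sum.LiftRel _ _ _ _)
  unfold before at h1 h2 h3 h4
  omega

/-- In a copy of N the two ends of the zigzag, elements 0 and 3, overlap in the forbidden way. -/
theorem IsIntervals.free_nPoset_iff (h : IsIntervals d l u) :
    Free nPoset (before l u) ↔ SEFree (matOf d (pairCount l u)) := by
  rw [seFree_iff h, Free, ← not_nonempty_iff, not_iff_not]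
  constructor
  · rintro ⟨e⟩
    have h1 : before l u (e 0) (e 2) := e.map_rel_iff.2 (by simp [nPoset])
    have h3 : before l u (e 1) (e 3) := e.map_rel_iff.2 (by simp [nPoset])
    have h4 : ¬ before l u (e 0) (e 3) := fun h => by simpa [nPoset] using e.map_rel_iff.1 h
    have h5 : ¬ before l u (e 3) (e 2) := fun h => by simpa [nPoset] using e.map_rel_iff.1 h
    have h6 : ¬ before l u (e 1) (e 0) := fun h => by simpa [nPoset] using e.map_rel_iff.1 h
    unfold before at *
    exact ⟨e 0, e 3, by omega, by omega, by omega⟩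
  · rintro ⟨x, y, h1, h2, h3⟩
    have := h.lt x
    have := h.lt y
    -- To complete overlapping x, y to N, z ends just before y starts, hence not before x starts; w
    -- starts just after x ends, hence not after y ends.
    obtain ⟨z, hz⟩ := h.surj_u (l y - 1) (by omega)
    obtain ⟨w, hw⟩ := h.surj_l (u x + 1) (by omega)
    have := h.le x
    have := h.le y
    have := h.le z
    have := h.le w
    have hrel : ∀ i j : Fin 4, before l u (![x, z, w, y] i) (![x, z, w, y] j) ↔ nPoset i j := by
      intro i j
      fin_cases i <;> fin_cases j <;> simp [before, nPoset] <;> omega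
    refine ⟨⟨⟨![x, z, w, y], fun i j hij => ?_⟩, fun {i j} => hrel i j⟩⟩
    have e1 := congrArg l hij
    have e2 := congrArg u hij
    revert e1 e2
    fin_cases i <;> fin_cases j <;> simp <;> omega

/-- The strict downsets of a `(2+2)`-free order form a chain. -/
theorem down_total {r : Fin n → Fin n → Prop} (hr : IsStrictOrder (Fin n) r)
    (hf : Free twoPlusTwo r) (x y : Fin n) : down r x ⊆ down r y ∨ down r y ⊆ down r x := by
  by_contra! hc
  obtain ⟨a, hax, hay⟩ := Set.not_subset.1 hc.1
  obtain ⟨b, hby, hbx⟩ := Set.not_subset.1 hc.2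
  change r a x at hax
  change ¬ r a y at hay
  change r b y at hby
  change ¬ r b x at hbx
  have ir := hr.irrefl
  have tr : ∀ {p q s}, r p q → r q s → r p s := fun {p q s} => hr.trans p q s
  -- Any further relation between the chains a < x and b < y would yield a < y or b < x, or a cycle,
  -- by transitivity.
  let f : Fin 2 ⊕ Fin 2 → Fin n := Sum.elim ![a, x] ![b, y]
  have hrel : ∀ i j, r (f i) (f j) ↔ twoPlusTwo i j := by
    have n1 : ¬ r x a := fun h => ir _ (tr hax h)
    have n2 : ¬ r y b := fun h => ir _ (tr hby h)
    have n3 : ¬ r a b := fun h => hay (tr h hby)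
    have n4 : ¬ r b a := fun h => hbx (tr h hax)
    have n5 : ¬ r x b := fun h => hay (tr (tr hax h) hby)
    have n6 : ¬ r y a := fun h => hbx (tr (tr hby h) hax)
    have n7 : ¬ r x y := fun h => hay (tr hax h)
    have n8 : ¬ r y x := fun h => hbx (tr hby h)
    rintro (i | i) (j | j) <;> fin_cases i <;> fin_cases j <;>
      simp [f, twoPlusTwo, ir, hax, hby, hay, hbx, n1, n2, n3, n4, n5, n6, n7, n8]
  have hax' : a ≠ x := fun h => ir _ (h ▸ hax)
  have hby' : b ≠ y := fun h => ir _ (h ▸ hby)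
  have m1 : a ≠ b := fun h => hay (h ▸ hby)
  have m2 : x ≠ y := fun h => hay (h ▸ hax)
  have m3 : a ≠ y := fun h => hbx (tr (h ▸ hby) hax)
  have m4 : b ≠ x := fun h => hay (tr (h ▸ hax) hby)
  refine hf.false ⟨⟨f, ?_⟩, fun {i j} => hrel i j⟩
  rintro (i | i) (j | j) hij <;> revert hij <;> fin_cases i <;> fin_cases j <;>
    simp [f, hax', hby', m1, m2, m3, m4, hax'.symm, hby'.symm, m1.symm, m2.symm, m3.symm, m4.symm]

/-- Every `(2+2)`-free order is the interval order of a reduced family of intervals. -/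
theorem exists_eq_before {r : Fin n → Fin n → Prop} (hn : 0 < n) (hr : IsStrictOrder (Fin n) r)
    (hf : Free twoPlusTwo r) : ∃ d l u, IsIntervals d l u ∧ r = before l u := by
  classical
  have : Nonempty (Fin n) := ⟨⟨0, hn⟩⟩
  let S : Finset (Set (Fin n)) := Finset.univ.image (down r)
  have hS : ∀ {D}, D ∈ S ↔ ∃ x, down r x = D := by simp [S]
  have hchain : ∀ {D E}, D ∈ S → E ∈ S → ¬ E ⊆ D → D ⊂ E := by
    intro D E hD hE hED
    obtain ⟨x, rfl⟩ := hS.1 hD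
    obtain ⟨y, rfl⟩ := hS.1 hE
    exact ⟨(down_total hr hf x y).resolve_right hED, hED⟩
  -- The downsets form a chain, so x ∈ D exactly when `co x ≤ rk D`. The interval of x is therefore
  -- from `rk (down r x)` to `co x - 1`.
  let rk : Set (Fin n) → ℕ := fun D => (S.filter (· ⊂ D)).card
  let co : Fin n → ℕ := fun x => (S.filter (x ∉ ·)).card
  have hmem : ∀ x, down r x ∈ S := fun x => hS.2 ⟨x, rfl⟩
  have hrk : ∀ {D E}, D ∈ S → D ⊂ E → rk D < rk E := by
    intro D E hD hDE
    refine Finset.card_lt_card (Finset.ssubset_iff_of_subset ?_ |>.2 ⟨D, ?_, ?_⟩)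
    · exact Finset.monotone_filter_right _ fun F _ hF => hF.trans hDE
    · exact Finset.mem_filter.2 ⟨hD, hDE⟩
    · exact fun h => (Finset.mem_filter.1 h).2.ne rfl
  have hrk_lt : ∀ {D}, D ∈ S → rk D < S.card := by
    intro D hD
    refine Finset.card_lt_card (Finset.filter_ssubset.2 ⟨D, hD, ?_⟩)
    exact fun h => h.ne rfl
  have hle_co : ∀ {D x}, D ∈ S → x ∉ D → rk D < co x := by
    intro D x hD hx
    refine Finset.card_lt_card (Finset.ssubset_iff_of_subset ?_ |>.2 ⟨D, ?_, ?_⟩)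
    · exact Finset.monotone_filter_right _ fun F _ hF hxF => hx (hF.subset hxF)
    · exact Finset.mem_filter.2 ⟨hD, hx⟩
    · exact fun h => (Finset.mem_filter.1 h).2.ne rfl
  have hco_le : ∀ {D x}, D ∈ S → x ∈ D → co x ≤ rk D := by
    intro D x hD hx
    refine Finset.card_le_card fun F hF => ?_
    rw [Finset.mem_filter] at hF ⊢
    exact ⟨hF.1, hchain hF.1 hD fun hDF => hF.2 (hDF hx)⟩
  have hrk_surj : ∀ v < S.card, ∃ D ∈ S, rk D = v := by
    have hinj : Set.InjOn rk S := by
      intro D hD E hE he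
      by_contra hne
      by_cases hED : E ⊆ D
      · exact (hrk hE (hED.ssubset_of_ne (Ne.symm hne))).ne he.symm
      · exact (hrk hD (hchain hD hE hED)).ne he
    have : S.image rk = Finset.range S.card := by
      refine Finset.eq_of_subset_of_card_le (fun v hv => ?_) ?_
      · obtain ⟨D, hD, rfl⟩ := Finset.mem_image.1 hv
        exact Finset.mem_range.2 (hrk_lt hD)
      · rw [Finset.card_image_of_injOn hinj, Finset.card_range]
    intro v hv
    exact Finset.mem_image.1 (this ▸ Finset.mem_range.2 hv)
  -- A minimal m has empty downset, which makes every `co` positive and the subtraction harmless. A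
  -- maximal t lies in no downset and attains the largest right endpoint.
  obtain ⟨m, -, hm⟩ := (Finite.wellFounded_of_trans_of_irrefl r).has_min Set.univ Set.univ_nonempty
  obtain ⟨t, -, ht⟩ := (Finite.wellFounded_of_trans_of_irrefl (Function.swap r)).has_min Set.univ
    Set.univ_nonempty
  have hco_pos : ∀ x, 0 < co x := fun x =>
    (Nat.zero_le _).trans_lt (hle_co (hmem m) (hm x trivial))
  have hco_card : ∀ x, co x ≤ S.card := fun x => Finset.card_filter_le _ _
  refine ⟨S.card, fun x => rk (down r x), fun x => co x - 1, ⟨fun x => ?_, fun x => ?_,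
    fun v hv => ?_, fun v hv => ?_⟩, ?_⟩
  · have := hle_co (hmem x) (hr.irrefl x)
    omega
  · have := hco_pos x
    have := hco_card x
    omega
  · obtain ⟨D, hD, rfl⟩ := hrk_surj v hv
    obtain ⟨x, rfl⟩ := hS.1 hD
    exact ⟨x, rfl⟩
  · obtain ⟨D, hD, rfl⟩ := hrk_surj v hv
    by_cases hlt : rk D + 1 < S.card
    · obtain ⟨E, hE, he⟩ := hrk_surj _ hlt
      have hED : ¬ E ⊆ D := by
        intro hED
        rcases eq_or_ne E D with rfl | hne
        · omega
        · have := hrk hE (hED.ssubset_of_ne hne)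
          omega
      obtain ⟨x, hxE, hxD⟩ := Set.not_subset.1 hED
      have h1 := hle_co hD hxD
      have h2 := hco_le hE hxE
      exact ⟨x, by omega⟩
    · have : co t = S.card := by
        refine congrArg Finset.card (Finset.filter_true_of_mem fun F hF => ?_)
        obtain ⟨x, rfl⟩ := hS.1 hF
        exact ht x trivial
      exact ⟨t, by omega⟩
  · funext x y
    have h0 := hco_pos x
    refine propext ⟨fun hxy => ?_, fun hxy => ?_⟩
    · have := hco_le (hmem y) (show x ∈ down r y from hxy)
      change co x - 1 < rk (down r y)
      omega
    · by_contra hc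
      have := hle_co (hmem y) (show x ∉ down r y from hc)
      have h : co x - 1 < rk (down r y) := hxy
      omega

/-! ### The maps on `101`-avoiding ascent sequences -/

theorem isIntervals_of_mem_CAsc {a : Fin n → ℕ} (ha : a ∈ CAsc n) :
    IsIntervals (numVals a) a (runMax a) where
  le _ := le_runMax a le_rfl
  lt := runMax_lt_numVals a
  surj_l _ hv := (mem_CAsc_iff.1 ha).1.exists_eq_of_lt_numVals hv
  surj_u v hv := by
    obtain ⟨j, -, hj, -⟩ := (mem_CAsc_iff.1 ha).1.exists_record hv
    exact ⟨j, hj⟩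

/-- If intervals x, y overlap in the forbidden way, then x precedes y and the value at y occurs
before x, where the entry is smaller: a 101. -/
theorem seFree_of_mem_CAsc {a : Fin n → ℕ} (ha : a ∈ CAsc n) :
    SEFree (matOf (numVals a) (pairCount a (runMax a))) := by
  rw [seFree_iff (isIntervals_of_mem_CAsc ha)]
  obtain ⟨h1, h2⟩ := mem_CAsc_iff.1 ha
  rintro ⟨x, y, hl, hu, hlu⟩
  obtain ⟨k, hk, e⟩ := h1.exists_eq_of_le_runMax hlu
  have hxy : x < y := lt_of_not_ge fun h => (runMax_mono a h).not_gt hu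
  rcases hk.lt_or_eq with hk | rfl
  · have := h2 k x y hk hxy e
    omega
  · omega

theorem pairCount_succ (l u : Fin (n + 1) → ℕ) (i j : ℕ) : pairCount l u i j =
    pairCount (fun x : Fin n => l x.castSucc) (fun x => u x.castSucc) i j +
      if l (Fin.last n) = i ∧ u (Fin.last n) = j then 1 else 0 := by
  classical
  have key : ∀ {m} (l u : Fin m → ℕ), pairCount l u i j =
      ∑ x, if l x = i ∧ u x = j then 1 else 0 := by
    intro m l u
    rw [pairCount, ← Finset.card_filter, ← Set.ncard_coe_finset]
    congr 1
    ext x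
    simp
  rw [key, key, Fin.sum_univ_castSucc]

theorem pairCount_runMax_succ (a : Fin (n + 1) → ℕ) (i j : ℕ) : pairCount a (runMax a) i j =
    pairCount (Fin.init a) (runMax (Fin.init a)) i j +
      if a (Fin.last n) = i ∧ numVals a = j + 1 then 1 else 0 := by
  rw [pairCount_succ]
  simp only [runMax_castSucc, ← runMax_last a, Nat.add_right_cancel_iff]
  rfl

theorem IsIntervals.lt_mindex (h : IsIntervals d l u) (hd : 0 < d) {v : ℕ}
    (hv : ∀ x, u x + 1 = d → v ≤ l x) : v < mindex (d := d) fun i j => pairCount l u i j := by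
  refine Nat.lt_of_succ_le (le_csInf ?_ ?_)
  · obtain ⟨x, hx⟩ := h.surj_u (d - 1) (by omega)
    exact ⟨_, ⟨l x, h.l_lt x⟩, ⟨u x, h.lt x⟩, by dsimp only; omega,
      pairCount_ne_zero.2 ⟨x, rfl, rfl⟩, rfl⟩
  · rintro k ⟨i, j, hj, hij, rfl⟩
    obtain ⟨x, hx, hx'⟩ := pairCount_ne_zero.1 hij
    have := hv x (by omega)
    omega

theorem mindex_le (M : Matrix (Fin d) (Fin d) ℕ) : mindex M ≤ d := by
  rcases Set.eq_empty_or_nonempty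
    {k | ∃ i j : Fin d, (j : ℕ) + 1 = d ∧ M i j ≠ 0 ∧ k = (i : ℕ) + 1} with h | h
  · rw [mindex, h, Nat.sInf_empty]
    exact Nat.zero_le d
  · obtain ⟨i, j, -, -, hk⟩ := Nat.sInf_mem h
    rw [mindex, hk]
    exact i.isLt

theorem amStep_matOf_of_lt {f : ℕ → ℕ → ℕ} {v : ℕ} (h : v < mindex (d := d) fun i j => f i j) :
    amStep (matOf d f) v = matOf d fun i j => f i j + if i = v ∧ j + 1 = d then 1 else 0 :=
  if_pos h

theorem amStep_matOf_self (d : ℕ) (f : ℕ → ℕ → ℕ) : amStep (matOf d f) d =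
    matOf (d + 1) fun i j => if i < d ∧ j < d then f i j else if i = d ∧ j = d then 1 else 0 := by
  have key : ∀ i j : Fin (d + 1), amAppend (fun i j : Fin d => f i j) i j =
      if (i : ℕ) < d ∧ (j : ℕ) < d then f i j else if (i : ℕ) = d ∧ (j : ℕ) = d then 1 else 0 := by
    intro i j
    induction i using Fin.lastCases with
    | last => simp [amAppend, Fin.ext_iff]
    | cast i =>
      induction j using Fin.lastCases with
      | last => simp [amAppend, i.isLt.ne]
      | cast j => simp [amAppend]
  exact (if_neg (mindex_le (d := d) fun i j => f i j).not_gt).trans ((if_pos rfl).trans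
    (congrArg (Sigma.mk (d + 1)) (funext fun i => funext fun j => key i j)))

/-- An old value lies below `mindex`, because the last column records the entries since the last new
maximum; a new maximum equals the dimension. Only increasing and appending occur. -/
theorem fAM_eq {n : ℕ} {a : Fin n → ℕ} (ha : a ∈ CAsc n) :
    fAM a = matOf (numVals a) (pairCount a (runMax a)) := by
  induction n with
  | zero =>
    exact (matOf_congr (numVals_of_isEmpty a).symm (fun i hi => absurd hi i.not_lt_zero) :
      matOf 0 (fun _ _ => 0) = _)
  | succ n ih =>
    obtain ⟨hb, hv⟩ := mem_CAsc_succ_iff.1 ha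
    have hI := isIntervals_of_mem_CAsc hb
    have hmax := numVals_eq_max a
    rw [fAM, ih hb]
    rcases hv.1.lt_or_eq with hlt | heq
    · rw [amStep_matOf_of_lt (hI.lt_mindex (by omega) fun x hx =>
        hv.le_of_runMax (mem_CAsc_iff.1 hb).1 hlt hx)]
      refine matOf_congr (by omega) ?_
      intro i hi j hj
      have : numVals a = numVals (Fin.init a) := by omega
      rw [pairCount_runMax_succ, this]
      simp only [eq_comm]
    · rw [heq, amStep_matOf_self]
      refine matOf_congr (by omega) ?_
      intro i hi j hj
      rw [pairCount_runMax_succ]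
      have hz : ¬ (i < numVals (Fin.init a) ∧ j < numVals (Fin.init a)) →
          pairCount (Fin.init a) (runMax (Fin.init a)) i j = 0 := by
        intro hc
        by_contra hne
        obtain ⟨x, rfl, rfl⟩ := pairCount_ne_zero.1 hne
        exact hc ⟨hI.l_lt x, hI.lt x⟩
      split_ifs with h1 h2 h3 h4 h5
      · omega
      · rfl
      · rw [hz h1]
      · omega
      · omega
      · rw [hz h1]

/-- Old running maxima do not change, and the new interval ends at the largest endpoint, so the new
element is maximal. -/
theorem addMax_eq_before {a : Fin (n + 1) → ℕ} {r : Fin n → Fin n → Prop} {D : Set (Fin n)}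
    (hr : r = before (Fin.init a) (runMax (Fin.init a)))
    (hD : D = {y | runMax (Fin.init a) y < a (Fin.last n)}) :
    addMax r D = before a (runMax a) := by
  funext x y
  induction x using Fin.lastCases with
  | last =>
    simp only [addMax, before, Fin.lastCases_last, eq_iff_iff, false_iff, not_lt]
    have := runMax_last a
    have := lt_numVals a y
    omega
  | cast x =>
    induction y using Fin.lastCases with
    | last => simp [addMax, before, hD, runMax_castSucc]
    | cast y => simp [addMax, before, hr, runMax_castSucc, Fin.init]

theorem labelledAP_eq {n : ℕ} {a : Fin n → ℕ} (ha : a ∈ CAsc n) :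
    labelledAP n a = before a (runMax a) := by
  induction n with
  | zero => exact funext fun x => x.elim0
  | succ n ih =>
    obtain ⟨hb, hv⟩ := mem_CAsc_succ_iff.1 ha
    have hI := isIntervals_of_mem_CAsc hb
    rw [labelledAP, ih hb, apStep]
    rcases hv.1.lt_or_eq with hlt | heq
    · rw [if_pos]
      · exact addMax_eq_before rfl (hI.downAt_eq hlt)
      · refine le_csInf ?_ ?_
        · obtain ⟨x, hx⟩ := hI.surj_u (numVals (Fin.init a) - 1) (by omega)
          exact ⟨_, x, (hI.isMaxElt_iff x).2 (by omega), rfl⟩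
        · rintro _ ⟨x, hx, rfl⟩
          rw [hI.level_eq]
          exact hv.le_of_runMax (mem_CAsc_iff.1 hb).1 hlt ((hI.isMaxElt_iff x).1 hx)
    · rcases Nat.eq_zero_or_pos n with rfl | hn
      · have h0 : a (Fin.last 0) = 0 := heq.trans (numVals_of_isEmpty _)
        rw [if_pos (h0.le.trans (Nat.zero_le _))]
        exact addMax_eq_before rfl (Set.ext fun x => x.elim0)
      · have hd := hI.pos hn
        rw [if_neg, if_pos (by rw [hI.ell_eq hd, heq])]
        · refine addMax_eq_before rfl (Set.eq_univ_of_forall fun x => ?_).symm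
          change runMax _ x < _
          rw [heq]
          exact hI.lt x
        · rw [heq, not_le]
          obtain ⟨x, hx⟩ := hI.surj_u (numVals (Fin.init a) - 1) (by omega)
          refine lt_of_le_of_lt (Nat.sInf_le ⟨x, (hI.isMaxElt_iff x).2 (by omega), rfl⟩) ?_
          rw [hI.level_eq]
          exact hI.l_lt x

/-- Positivity matters: the empty poset has a 1 × 1 matrix under `fPM`, the empty word a 0 × 0 one
under `fAM`. -/
theorem fPM_fAP {n : ℕ} (hn : 0 < n) {a : Fin n → ℕ} (ha : a ∈ CAsc n) : fPM (fAP a) = fAM a := by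
  change labelledPM (labelledAP n a) = _
  have hI := isIntervals_of_mem_CAsc ha
  rw [labelledAP_eq ha, hI.labelledPM_eq (hI.pos hn), fAM_eq ha]

/-! ### Bijectivity of the maps to matrices -/

theorem bijOn_fPM {n : ℕ} (hn : 0 < n) : Set.BijOn fPM (CPosets n) (CMatrices n) := by
  refine ⟨?_, ?_, ?_⟩
  · rintro _ ⟨r, rfl, h1, h2, h3⟩
    obtain ⟨d, l, u, h, rfl⟩ := exists_eq_before hn h1 h2
    change labelledPM _ ∈ _
    rw [h.labelledPM_eq (h.pos hn)]
    exact ⟨h.mem_matrices, h.free_nPoset_iff.1 h3⟩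
  · rintro _ ⟨r, rfl, h1, h2, -⟩ _ ⟨s, rfl, h1', h2', -⟩ he
    obtain ⟨d, l, u, h, rfl⟩ := exists_eq_before hn h1 h2
    obtain ⟨d', l', u', h', rfl⟩ := exists_eq_before hn h1' h2'
    change labelledPM _ = labelledPM _ at he
    rw [h.labelledPM_eq (h.pos hn), h'.labelledPM_eq (h'.pos hn)] at he
    -- A rearrangement of the intervals is an isomorphism of their interval orders.
    obtain ⟨σ, hσ⟩ := exists_perm_of_matOf_eq h h' he
    refine Quotient.sound ⟨⟨σ, fun {x y} => ?_⟩⟩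
    rw [before, before, (hσ x).2, (hσ y).1]
  · rintro M ⟨hM, hse⟩
    obtain ⟨l, u, h, e, -⟩ := exists_intervals hM
    refine ⟨Unlabelled.mk (before l u), ⟨_, rfl, h.isStrictOrder, before_free, ?_⟩, ?_⟩
    · rw [h.free_nPoset_iff, ← e]
      exact hse
    · exact (h.labelledPM_eq (h.pos hn)).trans e.symm

theorem bijOn_fAM (n : ℕ) : Set.BijOn fAM (CAsc n) (CMatrices n) := by
  refine ⟨fun a ha => ?_, fun a ha b hb he => ?_, fun M hM => ?_⟩
  · rw [fAM_eq ha]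
    exact ⟨(isIntervals_of_mem_CAsc ha).mem_matrices, seFree_of_mem_CAsc ha⟩
  · rw [fAM_eq ha, fAM_eq hb] at he
    obtain ⟨σ, hσ⟩ := exists_perm_of_matOf_eq (isIntervals_of_mem_CAsc ha)
      (isIntervals_of_mem_CAsc hb) he
    have ma := monotone_runMax_pair (mem_CAsc_iff.1 ha).1 (mem_CAsc_iff.1 ha).2
    have mb := monotone_runMax_pair (mem_CAsc_iff.1 hb).1 (mem_CAsc_iff.1 hb).2
    have e : (fun k => toLex (runMax a k, OrderDual.toDual (a k))) =
        (fun k => toLex (runMax b k, OrderDual.toDual (b k))) ∘ σ := by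
      funext k
      simp [hσ k]
    rw [e] at ma
    -- Both lists of pairs are sorted, and a sorted rearrangement is unique.
    have e' := e.trans (Tuple.unique_monotone (σ := σ) (τ := 1) ma mb)
    funext k
    exact congrArg (fun p => OrderDual.ofDual (ofLex p).2) (congrFun e' k)
  · obtain ⟨l, u, h, e, hmono⟩ := exists_intervals hM.1
    have hse := hM.2
    rw [e, seFree_iff h] at hse
    have hu : Monotone u := fun x y hxy => by
      rcases Prod.Lex.toLex_le_toLex.1 (hmono hxy) with h1 | h1
      · exact le_of_lt h1
      · exact le_of_eq h1.1
    have hl : ∀ {x y}, x ≤ y → u x = u y → l y ≤ l x := fun {x y} hxy e => by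
      rcases Prod.Lex.toLex_le_toLex.1 (hmono hxy) with h1 | h1
      · exact absurd e h1.ne
      · exact OrderDual.toDual_le_toDual.1 h1.2
    -- A diagonal interval at u x exists. If it comes after x, sortedness forces l x = u x, so x
    -- itself serves. This turns u into the running maximum of l.
    have hdiag : ∀ x, ∃ y ≤ x, l y = u x := by
      intro x
      obtain ⟨y, h1, h2⟩ := h.exists_diag hse (h.lt x)
      rcases le_total y x with hyx | hxy
      · exact ⟨y, hyx, h1⟩
      · have := hl hxy h2.symm
        have := h.le x
        exact ⟨x, le_rfl, by omega⟩
    have hrun : runMax l = u := by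
      funext x
      apply le_antisymm
      · exact runMax_le fun y hy => (h.le y).trans (hu hy)
      · obtain ⟨y, hy, e⟩ := hdiag x
        exact e ▸ le_runMax l hy
    have hmem : l ∈ CAsc n := by
      refine mem_CAsc_iff.2 ⟨fun k v hv => ?_, fun i j k hij hjk he => ?_⟩
      -- The diagonal interval at v ends before interval k starts, so it precedes k in the sorted
      -- order.
      · obtain ⟨y, h1, h2⟩ := h.exists_diag hse (hv.trans (h.l_lt k))
        refine ⟨y, lt_of_not_ge fun hky => ?_, h1⟩
        have := hu hky
        have := h.le k
        omega
      · by_contra! hc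
        have h1 := hu hij.le
        have h2 := hu hjk.le
        have h3 := h.le i
        -- Within one right endpoint the left endpoints decrease, so a 101 forces u j < u k and j, k
        -- overlap in the forbidden way.
        have h4 : u j ≠ u k := fun hjk' => by
          have := hl hjk.le hjk'
          omega
        exact hse ⟨j, k, by omega, by omega, by omega⟩
    have hnum : numVals l = M.1 := by
      apply le_antisymm
      · exact numVals_le h.l_lt
      · by_contra! hc
        obtain ⟨x, hx⟩ := h.surj_l _ hc
        have := lt_numVals l x
        omega
    refine ⟨l, hmem, ?_⟩
    rw [fAM_eq hmem, hrun, hnum, ← e]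

theorem bijOn_fAP {n : ℕ} (hn : 0 < n) : Set.BijOn fAP (CAsc n) (CPosets n) := by
  have hmaps : Set.MapsTo fAP (CAsc n) (CPosets n) := fun a ha => by
    have hI := isIntervals_of_mem_CAsc ha
    refine ⟨labelledAP n a, rfl, ?_⟩
    rw [labelledAP_eq ha]
    exact ⟨hI.isStrictOrder, before_free, hI.free_nPoset_iff.2 (seFree_of_mem_CAsc ha)⟩
  refine ⟨hmaps, fun a ha b hb he => ?_, fun P hP => ?_⟩
  · refine (bijOn_fAM n).injOn ha hb ?_
    rw [← fPM_fAP hn ha, ← fPM_fAP hn hb, he]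
  · obtain ⟨a, ha, e⟩ := (bijOn_fAM n).surjOn ((bijOn_fPM hn).mapsTo hP)
    exact ⟨a, ha, (bijOn_fPM hn).injOn (hmaps ha) hP ((fPM_fAP hn ha).trans e)⟩

/-! ### Permutations avoiding `231` -/

/-- Avoidance of `231`, spelled out. -/
def Avoids231 {n : ℕ} (π : Equiv.Perm (Fin n)) : Prop :=
  ∀ i j k, i < j → j < k → π i < π j → π i ≤ π k

theorem mem_CPerms_iff {n : ℕ} {π : Equiv.Perm (Fin n)} : π ∈ CPerms n ↔ Avoids231 π := by
  change ¬ ContainsPattern π ![2, 3, 1] ↔ _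
  rw [containsPattern_three_iff, Avoids231]
  simp only [not_exists, not_and]
  refine forall_congr' fun i => forall_congr' fun j => forall_congr' fun k => ?_
  refine imp_congr_right fun hij => imp_congr_right fun hjk => ?_
  simp [Fin.forall_fin_succ]
  have h1 := π.injective.ne hij.ne
  have h2 := π.injective.ne hjk.ne
  omega

/-- The letters of `π` before site `p` are smaller than the letters after it. -/
def IsSplit {n : ℕ} (π : Equiv.Perm (Fin n)) (p : ℕ) : Prop :=
  p ≤ n ∧ ∀ i j : Fin n, (i : ℕ) < p → p ≤ j → π i < π j

theorem insertMax_self (π : Equiv.Perm (Fin n)) (p : Fin (n + 1)) :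
    insertMax π p p = Fin.last n := by
  simp [insertMax]

theorem insertMax_succAbove (π : Equiv.Perm (Fin n)) (p : Fin (n + 1)) (i : Fin n) :
    insertMax π p (p.succAbove i) = (π i).castSucc := by
  simp [insertMax]

/-- Every permutation arises from a shorter one by inserting a new largest letter. -/
theorem exists_eq_insertMax (ρ : Equiv.Perm (Fin (n + 1))) : ∃ π p, ρ = insertMax π p := by
  obtain ⟨p, hp⟩ := ρ.surjective (Fin.last n)
  have hne : ∀ i, ρ (p.succAbove i) ≠ Fin.last n := fun i h =>
    Fin.succAbove_ne p i (ρ.injective (h.trans hp.symm))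
  have hinj : Function.Injective fun i => (ρ (p.succAbove i)).castPred (hne i) := fun i j h =>
    Fin.succAbove_right_injective (ρ.injective (Fin.castPred_inj.1 h))
  refine ⟨Equiv.ofBijective _ (Finite.injective_iff_bijective.1 hinj), p, Equiv.ext fun x => ?_⟩
  rcases Fin.eq_self_or_eq_succAbove p x with rfl | ⟨i, rfl⟩
  · rw [hp, insertMax_self]
  · rw [insertMax_succAbove]
    simp

theorem insertMax_inj {π π' : Equiv.Perm (Fin n)} {p p' : Fin (n + 1)} :
    insertMax π p = insertMax π' p' ↔ π = π' ∧ p = p' := by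
  refine ⟨fun h => ?_, fun h => by rw [h.1, h.2]⟩
  have hp : p = p' := (insertMax π p).injective (by rw [insertMax_self, h, insertMax_self])
  subst hp
  refine ⟨Equiv.ext fun i => ?_, rfl⟩
  have := congrArg (· (p.succAbove i)) h
  simpa [insertMax_succAbove] using this

theorem val_succAbove (p : Fin (n + 1)) (i : Fin n) :
    (p.succAbove i : ℕ) = if (i : ℕ) < p then (i : ℕ) else i + 1 := by
  simp only [Fin.succAbove, Fin.lt_def, Fin.val_castSucc]
  split_ifs <;> simp

/-- A new largest letter can only play the 3, and does so exactly when some letter before it exceeds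
one after it. -/
theorem avoids231_insertMax_iff {π : Equiv.Perm (Fin n)} {p : Fin (n + 1)} :
    Avoids231 (insertMax π p) ↔ Avoids231 π ∧ IsSplit π p := by
  constructor
  · intro h
    refine ⟨fun i j k hij hjk hlt => ?_, p.is_le, fun i j hi hj => ?_⟩
    · have := h (p.succAbove i) (p.succAbove j) (p.succAbove k)
      simp only [insertMax_succAbove, Fin.succAbove_lt_succAbove_iff, Fin.castSucc_lt_castSucc_iff,
        Fin.castSucc_le_castSucc_iff] at this
      exact this hij hjk hlt
    · have := h (p.succAbove i) p (p.succAbove j)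
      simp only [insertMax_succAbove, insertMax_self, Fin.lt_def, val_succAbove,
        Fin.castSucc_le_castSucc_iff] at this
      have h1 : π i ≤ π j := this (by simp [hi]) (by rw [if_neg (by omega)]; omega) (by simp)
      refine lt_of_le_of_ne h1 fun e => ?_
      have := π.injective e
      subst this
      omega
  · rintro ⟨h, hs⟩ i j k hij hjk hlt
    rcases Fin.eq_self_or_eq_succAbove p i with rfl | ⟨i, rfl⟩
    · rw [insertMax_self] at hlt
      exact absurd hlt (Fin.le_last _).not_gt
    rcases Fin.eq_self_or_eq_succAbove p k with rfl | ⟨k, rfl⟩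
    · rw [insertMax_self]
      exact Fin.le_last _
    rw [insertMax_succAbove, insertMax_succAbove, Fin.castSucc_le_castSucc_iff]
    rcases Fin.eq_self_or_eq_succAbove p j with rfl | ⟨j, rfl⟩
    · rw [Fin.lt_def, val_succAbove] at hij hjk
      exact (hs.2 i k (by split_ifs at hij <;> omega) (by split_ifs at hjk <;> omega)).le
    · rw [insertMax_succAbove, insertMax_succAbove, Fin.castSucc_lt_castSucc_iff] at hlt
      rw [Fin.succAbove_lt_succAbove_iff] at hij hjk
      exact h i j k hij hjk hlt

/-! ### Active sites and split sites under insertion -/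

theorem isActive_last (π : Equiv.Perm (Fin n)) : IsActive π n := Or.inr (Or.inl rfl)

/-- The predecessor of the letter just before a split site is smaller, hence also left of the site,
and so left of that letter. -/
theorem IsSplit.isActive {π : Equiv.Perm (Fin n)} {p : ℕ} (h : IsSplit π p) : IsActive π p := by
  rcases Nat.eq_zero_or_pos p with h0 | h0
  · exact Or.inl h0
  · have hp := h.1
    refine Or.inr (Or.inr ⟨⟨p - 1, by omega⟩, by simp; omega, ?_⟩)
    by_cases hz : (π ⟨p - 1, by omega⟩ : ℕ) = 0
    · exact Or.inl hz
    · right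
      obtain ⟨t, ht⟩ := π.surjective ⟨π ⟨p - 1, by omega⟩ - 1, by omega⟩
      have ht' := congrArg Fin.val ht
      dsimp only at ht'
      refine ⟨t, ?_, by omega⟩
      by_contra hc
      rw [Fin.lt_def] at hc
      dsimp only at hc
      rcases Nat.lt_or_ge t p with h1 | h1
      · have : t = ⟨p - 1, by omega⟩ := Fin.ext (by dsimp only; omega)
        rw [this] at ht'
        omega
      · have := h.2 ⟨p - 1, by omega⟩ t (by dsimp only; omega) h1
        rw [Fin.lt_def] at this
        omega

theorem isSplit_last (π : Equiv.Perm (Fin n)) : IsSplit π n :=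
  ⟨le_rfl, fun _ j _ hj => absurd j.isLt (not_lt.2 hj)⟩

/-- The largest letter must lie to the right of every split site except the final one. -/
theorem isSplit_insertMax_iff {π : Equiv.Perm (Fin n)} {p : Fin (n + 1)} {s : ℕ} :
    IsSplit (insertMax π p) s ↔ (IsSplit π s ∧ s ≤ p) ∨ s = n + 1 := by
  constructor
  · intro h
    rcases h.1.lt_or_eq with h1 | h1
    · left
      have hsp : s ≤ p := by
        by_contra! hc
        have := h.2 p ⟨s, h1⟩ hc le_rfl
        rw [insertMax_self] at this
        exact (Fin.le_last _).not_gt this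
      refine ⟨⟨by omega, fun i j hi hj => ?_⟩, hsp⟩
      have := h.2 (p.succAbove i) (p.succAbove j) (by rw [val_succAbove]; split_ifs <;> omega)
        (by rw [val_succAbove]; split_ifs <;> omega)
      simpa [insertMax_succAbove] using this
    · exact Or.inr h1
  · rintro (⟨h, hsp⟩ | rfl)
    · refine ⟨by have := h.1; omega, fun i j hi hj => ?_⟩
      rcases Fin.eq_self_or_eq_succAbove p i with rfl | ⟨i, rfl⟩
      · omega
      rcases Fin.eq_self_or_eq_succAbove p j with rfl | ⟨j, rfl⟩
      · rw [insertMax_self, insertMax_succAbove]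
        exact Fin.castSucc_lt_last _
      · rw [insertMax_succAbove, insertMax_succAbove, Fin.castSucc_lt_castSucc_iff]
        rw [val_succAbove] at hi hj
        exact h.2 i j (by split_ifs at hi <;> omega) (by split_ifs at hj <;> omega)
    · exact isSplit_last _

/-- The condition on the letter at position `q` that makes the site after it active. -/
theorem isActive_succ_iff {π : Equiv.Perm (Fin n)} (q : Fin n) (hq : (q : ℕ) + 1 ≠ n) :
    IsActive π (q + 1) ↔ (π q : ℕ) = 0 ∨ ∃ t < q, (π t : ℕ) + 1 = (π q : ℕ) := by
  constructor
  · rintro (h | h | ⟨q', h, h'⟩)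
    · omega
    · omega
    · obtain rfl : q' = q := Fin.ext (by omega)
      exact h'
  · exact fun h => Or.inr (Or.inr ⟨q, rfl, h⟩)

theorem not_isActive_of_lt {π : Equiv.Perm (Fin n)} {s : ℕ} (h : n < s) : ¬ IsActive π s := by
  rintro (h | h | ⟨q, hq, -⟩) <;> omega

theorem isActive_insertMax_of_le {π : Equiv.Perm (Fin n)} {p : Fin (n + 1)} (h : IsSplit π p)
    {s : ℕ} (hs : s ≤ p) : IsActive (insertMax π p) s ↔ IsActive π s := by
  have hp := p.is_le
  rcases hs.lt_or_eq with hs | rfl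
  · rcases Nat.eq_zero_or_pos s with rfl | h0
    · exact iff_of_true (Or.inl rfl) (Or.inl rfl)
    obtain ⟨q, rfl⟩ : ∃ q : Fin n, (q : ℕ) + 1 = s := ⟨⟨s - 1, by omega⟩, by simp; omega⟩
    have hval : ∀ t : Fin n, (t : ℕ) < p → p.succAbove t = t.castSucc := fun t ht =>
      Fin.ext (by rw [val_succAbove, if_pos ht]; rfl)
    have hq := isActive_succ_iff (π := insertMax π p) (p.succAbove q)
      (by rw [hval q (by omega), Fin.val_castSucc]; omega)
    rw [insertMax_succAbove, hval q (by omega), Fin.val_castSucc, Fin.val_castSucc] at hq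
    rw [hq, isActive_succ_iff q (by omega)]
    refine or_congr_right ⟨?_, ?_⟩
    · rintro ⟨t, ht, e⟩
      obtain ⟨t, rfl⟩ := Fin.exists_castSucc_eq.2 (ht.trans (Fin.castSucc_lt_last q)).ne
      have ht : t < q := by simpa using ht
      have ht' : (t : ℕ) < q := ht
      rw [← hval t (by omega), insertMax_succAbove] at e
      exact ⟨t, ht, e⟩
    · rintro ⟨t, ht, e⟩
      have ht' : (t : ℕ) < q := ht
      refine ⟨t.castSucc, by simpa using ht, ?_⟩
      rw [← hval t (by omega), insertMax_succAbove]
      exact e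
  · exact iff_of_true (isSplit_insertMax_iff.2 (Or.inl ⟨h, le_rfl⟩)).isActive h.isActive

/-- The letter right after the split site exceeds all letters before it, so the predecessor of the
new largest letter lies to its right. -/
theorem not_isActive_insertMax {π : Equiv.Perm (Fin n)} {p : Fin (n + 1)} (h : IsSplit π p)
    (hp : (p : ℕ) < n) : ¬ IsActive (insertMax π p) (p + 1) := by
  rw [isActive_succ_iff p (by omega), insertMax_self]
  rintro (h0 | ⟨t, ht, e⟩)
  · rw [Fin.val_last] at h0
    omega
  · have ht' : (t : ℕ) < p := ht
    rcases Fin.eq_self_or_eq_succAbove p t with rfl | ⟨t, rfl⟩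
    · omega
    rw [insertMax_succAbove] at e
    rw [val_succAbove] at ht'
    have := h.2 t ⟨p, hp⟩ (by split_ifs at ht' <;> omega) le_rfl
    have h2 := (π ⟨p, hp⟩).isLt
    rw [Fin.lt_def] at this
    simp at e
    omega

/-- The new letter is nobody's predecessor and the others keep their relative positions. -/
theorem isActive_insertMax_succ {π : Equiv.Perm (Fin n)} {p : Fin (n + 1)} {s : ℕ} (hs : p < s) :
    IsActive (insertMax π p) (s + 1) ↔ IsActive π s := by
  rcases lt_trichotomy s n with hlt | rfl | hlt
  · obtain ⟨q, rfl⟩ : ∃ q : Fin n, (q : ℕ) + 1 = s := ⟨⟨s - 1, by omega⟩, by simp; omega⟩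
    have hval : (p.succAbove q : ℕ) = q + 1 := by rw [val_succAbove, if_neg (by omega)]
    rw [isActive_succ_iff q (by omega), ← hval, isActive_succ_iff (p.succAbove q) (by omega),
      insertMax_succAbove, Fin.val_castSucc]
    refine or_congr_right ⟨?_, ?_⟩
    · rintro ⟨t, ht, e⟩
      rcases Fin.eq_self_or_eq_succAbove p t with rfl | ⟨t, rfl⟩
      · rw [insertMax_self, Fin.val_last] at e
        omega
      · rw [insertMax_succAbove] at e
        exact ⟨t, by simpa using ht, e⟩
    · rintro ⟨t, ht, e⟩
      exact ⟨p.succAbove t, by simpa using ht, by rw [insertMax_succAbove]; exact e⟩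
  · exact iff_of_true (isActive_last _) (isActive_last _)
  · exact iff_of_false (not_isActive_of_lt (by omega)) (not_isActive_of_lt hlt)

/-! ### Labels of sites -/

open Classical in
/-- The label of a site: the number of active sites to the left of it. -/
noncomputable def label (π : Equiv.Perm (Fin n)) (s : ℕ) : ℕ := Nat.count (IsActive π) s

theorem label_le_iff {π : Equiv.Perm (Fin n)} {s t : ℕ} (ht : IsActive π t) :
    label π s ≤ label π t ↔ s ≤ t := by
  classical
  refine ⟨fun h => ?_, fun h => Nat.count_monotone _ h⟩
  by_contra! hc
  exact (Nat.count_strict_mono ht hc).not_ge h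

theorem nth_label {π : Equiv.Perm (Fin n)} {s : ℕ} (hs : IsActive π s) :
    Nat.nth (IsActive π) (label π s) = s := by
  classical
  exact Nat.nth_count hs

open Classical in
theorem label_succ (π : Equiv.Perm (Fin n)) (s : ℕ) :
    label π (s + 1) = label π s + if IsActive π s then 1 else 0 :=
  Nat.count_succ _ _

theorem label_insertMax_of_le {π : Equiv.Perm (Fin n)} {p : Fin (n + 1)} (h : IsSplit π p)
    {s : ℕ} (hs : s ≤ p) : label (insertMax π p) s = label π s := by
  induction s with
  | zero => simp [label]
  | succ s ih =>
    rw [label_succ, label_succ, ih (by omega)]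
    classical exact congrArg _ (if_congr (isActive_insertMax_of_le h (by omega)) rfl rfl)

theorem label_insertMax_self_succ {π : Equiv.Perm (Fin n)} {p : Fin (n + 1)} (h : IsSplit π p) :
    label (insertMax π p) (p + 1) = label π p + 1 := by
  rw [label_succ, label_insertMax_of_le h le_rfl,
    if_pos ((isActive_insertMax_of_le h le_rfl).2 h.isActive)]

/-- Insertion doubles the site p but only the left copy is active, so labels further right are kept.
-/
theorem label_insertMax_succ {π : Equiv.Perm (Fin n)} {p : Fin (n + 1)} (h : IsSplit π p)
    (hp : (p : ℕ) < n) {s : ℕ} (hs : (p : ℕ) + 1 ≤ s) :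
    label (insertMax π p) (s + 1) = label π s := by
  induction s, hs using Nat.le_induction with
  | base =>
    rw [label_succ, label_insertMax_self_succ h, if_neg (not_isActive_insertMax h hp), label_succ,
      if_pos h.isActive]
  | succ s hs ih =>
    rw [label_succ, ih, label_succ π]
    classical exact congrArg _ (if_congr (isActive_insertMax_succ hs) rfl rfl)

/-- This is the recursion of `numVals_eq_max`, with the label of p as the new entry. -/
theorem label_insertMax_last {π : Equiv.Perm (Fin n)} {p : Fin (n + 1)} (h : IsSplit π p) :
    label (insertMax π p) (n + 1) = max (label π n) (label π p + 1) := by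
  rcases (p.is_le).lt_or_eq with hp | hp
  · have h1 := (label_le_iff (s := n) h.isActive).not.2 hp.not_ge
    rw [label_insertMax_succ h hp hp]
    omega
  · have h1 := label_insertMax_self_succ h
    simp only [hp] at h1 ⊢
    omega

/-! ### The map from ascent sequences to permutations -/

/-- The three claims need each other in the induction: an admissible entry labels a split site,
insertion there keeps 231-avoidance, and the final site's label is the next new maximum. -/
theorem fAS_spec {n : ℕ} {a : Fin n → ℕ} (ha : a ∈ CAsc n) :
    Avoids231 (fAS a) ∧ label (fAS a) n = numVals a ∧
      ∀ v, Allowed a v ↔ ∃ s, IsSplit (fAS a) s ∧ label (fAS a) s = v := by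
  induction n with
  | zero =>
    have h0 := numVals_of_isEmpty a
    refine ⟨fun i => i.elim0, by simp [label, h0], fun v => ?_⟩
    constructor
    · intro hv
      have := hv.1
      exact ⟨0, isSplit_last _, by simp [label]; omega⟩
    · rintro ⟨s, hs, rfl⟩
      obtain rfl : s = 0 := by simpa using hs.1
      exact ⟨by simp [label], fun i => i.elim0⟩
  | succ n ih =>
    obtain ⟨hb, hv⟩ := mem_CAsc_succ_iff.1 ha
    obtain ⟨h1, h2, h3⟩ := ih hb
    obtain ⟨s, hs, hsv⟩ := (h3 _).1 hv
    obtain ⟨p, rfl⟩ : ∃ p : Fin (n + 1), (p : ℕ) = s := ⟨⟨s, Nat.lt_succ_of_le hs.1⟩, rfl⟩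
    have hF : fAS a = insertMax (fAS (Fin.init a)) p := by
      rw [fAS, ← hsv, nth_label hs.isActive]
      simp
    have hnum : label (fAS a) (n + 1) = numVals a := by
      rw [hF, label_insertMax_last hs, h2, hsv, numVals_eq_max]
    refine ⟨hF ▸ avoids231_insertMax_iff.2 ⟨h1, hs⟩, hnum, fun w => ?_⟩
    rw [allowed_succ_iff ha, h3]
    constructor
    · rintro (⟨⟨t, ht, rfl⟩, hle⟩ | rfl)
      · rw [← hsv, label_le_iff hs.isActive] at hle
        refine ⟨t, hF ▸ isSplit_insertMax_iff.2 (Or.inl ⟨ht, hle⟩), ?_⟩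
        rw [hF, label_insertMax_of_le hs hle]
      · exact ⟨n + 1, isSplit_last _, hnum⟩
    · rintro ⟨t, ht, rfl⟩
      rw [hF, isSplit_insertMax_iff] at ht
      rcases ht with ⟨ht, hle⟩ | rfl
      · rw [hF, label_insertMax_of_le hs hle]
        exact Or.inl ⟨⟨t, ht, rfl⟩, hsv ▸ (label_le_iff hs.isActive).2 hle⟩
      · exact Or.inr hnum

theorem fAS_succ {n : ℕ} {a : Fin (n + 1) → ℕ} {p : Fin (n + 1)}
    (hp : IsSplit (fAS (Fin.init a)) p) (hlabel : label (fAS (Fin.init a)) p = a (Fin.last n)) :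
    fAS a = insertMax (fAS (Fin.init a)) p := by
  rw [fAS, ← hlabel, nth_label hp.isActive]
  simp

theorem bijOn_fAS (n : ℕ) : Set.BijOn fAS (CAsc n) (CPerms n) := by
  refine ⟨fun a ha => mem_CPerms_iff.2 (fAS_spec ha).1, ?_, ?_⟩
  · induction n with
    | zero => exact fun a _ b _ _ => Subsingleton.elim a b
    | succ n ih =>
      intro a ha b hb he
      have key : ∀ {a}, a ∈ CAsc (n + 1) → ∃ p : Fin (n + 1),
          fAS a = insertMax (fAS (Fin.init a)) p ∧ label (fAS (Fin.init a)) p = a (Fin.last n) := by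
        intro a ha
        obtain ⟨h, hv⟩ := mem_CAsc_succ_iff.1 ha
        obtain ⟨s, hs, e⟩ := ((fAS_spec h).2.2 _).1 hv
        exact ⟨⟨s, Nat.lt_succ_of_le hs.1⟩, fAS_succ hs e, e⟩
      obtain ⟨p, hp, ep⟩ := key ha
      obtain ⟨q, hq, eq⟩ := key hb
      rw [hp, hq, insertMax_inj] at he
      have hinit := ih (mem_CAsc_succ_iff.1 ha).1 (mem_CAsc_succ_iff.1 hb).1 he.1
      have hlast : a (Fin.last n) = b (Fin.last n) := by rw [← ep, ← eq, he.1, he.2]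
      rw [← Fin.snoc_init_self a, ← Fin.snoc_init_self b, hinit, hlast]
  · induction n with
    | zero => exact fun π _ => ⟨Fin.elim0, mem_CAsc_iff.2 ⟨fun i => i.elim0, fun i => i.elim0⟩,
        Subsingleton.elim _ _⟩
    | succ n ih =>
      intro ρ hρ
      obtain ⟨π, p, rfl⟩ := exists_eq_insertMax ρ
      obtain ⟨hπ, hp⟩ := avoids231_insertMax_iff.1 (mem_CPerms_iff.1 hρ)
      obtain ⟨b, hb, rfl⟩ := ih (mem_CPerms_iff.2 hπ)
      -- The preimage is a preimage of the shorter permutation followed by the label of the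
      -- insertion site.
      have hinit : Fin.init (Fin.snoc b (label (fAS b) p) : Fin (n + 1) → ℕ) = b := Fin.init_snoc ..
      have hlast : (Fin.snoc b (label (fAS b) p) : Fin (n + 1) → ℕ) (Fin.last n) =
          label (fAS b) p := Fin.snoc_last ..
      refine ⟨(Fin.snoc b (label (fAS b) p) : Fin (n + 1) → ℕ), mem_CAsc_succ_iff.2 ?_, ?_⟩
      · rw [hinit, hlast]
        exact ⟨hb, ((fAS_spec hb).2.2 _).2 ⟨p, hp, rfl⟩⟩
      · rw [fAS_succ (p := p) (by rw [hinit]; exact hp) (by rw [hinit, hlast]), hinit]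

end Fishburn

theorem mainTheorem7 (n : ℕ) (hn : 1 ≤ n) :
    Set.BijOn Fishburn.fAP (Fishburn.CAsc n) (Fishburn.CPosets n) ∧
    Set.BijOn Fishburn.fPM (Fishburn.CPosets n) (Fishburn.CMatrices n) ∧
    Set.BijOn Fishburn.fAS (Fishburn.CAsc n) (Fishburn.CPerms n) ∧
    Set.BijOn Fishburn.fAM (Fishburn.CAsc n) (Fishburn.CMatrices n) :=
  ⟨Fishburn.bijOn_fAP hn, Fishburn.bijOn_fPM hn, Fishburn.bijOn_fAS n, Fishburn.bijOn_fAM n⟩
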